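/- Let $L$ be an abelian group and let $R=\bigoplus_{l\in L}R_l$ be an $L$-graded commutative regular ring (Noetherian, with all localizations at prime ideals regular local rings) of finite Krull dimension $n$. Let $w\in R$ be a homogeneous non-zero-divisor of degree $\vec w\in L$, and give $A=R/(w)$ the induced $L$-grading. Let $\mathrm{gr}^L A$ be the abelian category of finitely generated $L$-graded $A$-modules and degree-preserving $A$-linear maps, with grading shifts $N(l)_m=N_{l+m}$. Let $D^b(\mathrm{gr}^L A)$ be its bounded derived category, and let $D^L_{\mathrm{sg}}(A)=D^b(\mathrm{gr}^L A)/\mathrm{Perf}^L(A)$ be the Verdier quotient by the perfect complexes, i.e. the complexes isomorphic in $D^b(\mathrm{gr}^L A)$ to bounded complexes of projective objects of $\mathrm{gr}^L A$. Then for all $M,N\in\mathrm{gr}^L A$, every integer $i$, and every integer $j\ge\frac{n-i}{2}$, there is an isomorphism of abelian groups $$\operatorname{Hom}_{D^L_{\mathrm{sg}}(A)}(M,N[i])\;\cong\;\operatorname{Hom}_{D^b(\mathrm{gr}^L A)}\bigl(M,\,N(-j\vec w)[i+2j]\bigr),$$ and for fixed $N,i,j$ these isomorphisms can be chosen natural in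 $M$ (in particular, linear over the degree-zero part of $A$). -/

import Mathlib

open CategoryTheory CategoryTheory.Limits

universe u v

/-! ### Gradings by subgroups -/

namespace SubgroupGrading

variable {L : Type v} [DecidableEq L] {M : Type*} [AddCommGroup M] (ℳ : L → AddSubgroup M)

theorem isInternal_of_components (c : L → M →+ M) (hself : ∀ i, ∀ x ∈ ℳ i, c i x = x)
    (hne : ∀ i j, i ≠ j → ∀ x ∈ ℳ j, c i x = 0) (htop : ⨆ i, ℳ i = ⊤) :
    DirectSum.IsInternal ℳ := by
  constructor
  · rw [injective_iff_map_eq_zero]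
    intro x hx
    have key : ∀ (i : L) (y : DirectSum L fun i => ℳ i),
        c i (DirectSum.coeAddMonoidHom ℳ y) = (y i : M) := by
      intro i y
      induction y using DirectSum.induction_on with
      | zero => simp
      | of j z =>
        rw [DirectSum.coeAddMonoidHom_of]
        by_cases h : i = j
        · subst h
          rw [hself i _ z.2, DirectSum.of_eq_same]
        · rw [hne i j h _ z.2, DirectSum.of_eq_of_ne _ _ _ h]
          rfl
      | add a b ha hb => rw [map_add, map_add, ha, hb]; rfl
    ext i
    rw [← key i x, hx, map_zero]
    rfl
  · intro x
    have hx : x ∈ ⨆ i, ℳ i := htop ▸ AddSubgroup.mem_top x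
    induction hx using AddSubgroup.iSup_induction' with
    | hp i y hy => exact ⟨DirectSum.of (fun i => ℳ i) i ⟨y, hy⟩, DirectSum.coeAddMonoidHom_of _ _ _⟩
    | h1 => exact ⟨0, map_zero _⟩
    | hadd a b _ _ ha hb =>
      obtain ⟨a', rfl⟩ := ha
      obtain ⟨b', rfl⟩ := hb
      exact ⟨a' + b', map_add _ _ _⟩

variable {ℳ}

/-- The homogeneous component of degree `i`. -/
noncomputable def comp (h : DirectSum.IsInternal ℳ) (i : L) : M →+ M :=
  (ℳ i).subtype.comp ((DFinsupp.evalAddMonoidHom i).comp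
    (AddEquiv.ofBijective (DirectSum.coeAddMonoidHom ℳ) h).symm.toAddMonoidHom)

theorem comp_mem (h : DirectSum.IsInternal ℳ) (i : L) (x : M) : comp h i x ∈ ℳ i := SetLike.coe_mem _

theorem comp_coe (h : DirectSum.IsInternal ℳ) (i : L) (y : DirectSum L fun i => ℳ i) :
    comp h i (DirectSum.coeAddMonoidHom ℳ y) = (y i : M) := by
  have : (AddEquiv.ofBijective (DirectSum.coeAddMonoidHom ℳ) h).symm
      (DirectSum.coeAddMonoidHom ℳ y) = y :=
    (AddEquiv.ofBijective (DirectSum.coeAddMonoidHom ℳ) h).symm_apply_apply y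
  exact congrArg (fun z : DirectSum L fun i => ℳ i => (z i : M)) this

theorem comp_self (h : DirectSum.IsInternal ℳ) (i : L) (x : M) (hx : x ∈ ℳ i) : comp h i x = x := by
  have := comp_coe h i (DirectSum.of (fun i => ℳ i) i ⟨x, hx⟩)
  rwa [DirectSum.coeAddMonoidHom_of, DirectSum.of_eq_same] at this

theorem comp_ne (h : DirectSum.IsInternal ℳ) (i j : L) (hij : i ≠ j) (x : M) (hx : x ∈ ℳ j) : comp h i x = 0 := by
  have := comp_coe h i (DirectSum.of (fun i => ℳ i) j ⟨x, hx⟩)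
  rwa [DirectSum.coeAddMonoidHom_of, DirectSum.of_eq_of_ne _ _ _ hij] at this

theorem sum_comp (h : DirectSum.IsInternal ℳ) (x : M) : ∃ s : Finset L, x = ∑ i ∈ s, comp h i x := by
  classical
  obtain ⟨y, rfl⟩ := h.2 x
  refine ⟨DFinsupp.support y, ?_⟩
  simp only [comp_coe]
  exact DirectSum.coeAddMonoidHom_eq_dfinsuppSum ℳ y

theorem iSup_eq_top (h : DirectSum.IsInternal ℳ) : ⨆ i, ℳ i = ⊤ := by
  rw [eq_top_iff]
  intro x _
  obtain ⟨s, hs⟩ := sum_comp h x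
  rw [hs]
  exact sum_mem fun i _ => AddSubgroup.mem_iSup_of_mem i (comp_mem h i x)

theorem comp_map (h : DirectSum.IsInternal ℳ) {N : Type*} [AddCommGroup N] {𝒩 : L → AddSubgroup N}
    (h' : DirectSum.IsInternal 𝒩) (f : M →+ N) (hf : ∀ i, ∀ x ∈ ℳ i, f x ∈ 𝒩 i) (i : L) (x : M) :
    comp h' i (f x) = f (comp h i x) := by
  have hx : x ∈ ⨆ i, ℳ i := iSup_eq_top h ▸ AddSubgroup.mem_top x
  induction hx using AddSubgroup.iSup_induction' with
  | hp j y hy =>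
    by_cases hij : i = j
    · subst hij
      rw [comp_self h' i _ (hf _ _ hy), comp_self h i _ hy]
    · rw [comp_ne h' i j hij _ (hf _ _ hy), comp_ne h i j hij _ hy, map_zero]
  | h1 => simp
  | hadd a b _ _ ha hb => simp only [map_add, ha, hb]

/-- A subgroup containing the homogeneous components of its elements inherits the grading. -/
theorem isInternal_comap (h : DirectSum.IsInternal ℳ) (K : AddSubgroup M) (hK : ∀ i, ∀ x ∈ K, comp h i x ∈ K) :
    DirectSum.IsInternal fun i => (ℳ i).comap K.subtype := by
  refine isInternal_of_components _
    (fun i => ((comp h i).comp K.subtype).codRestrict K fun x => hK i x x.2) ?_ ?_ ?_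
  · intro i x hx
    exact Subtype.ext (comp_self h i x hx)
  · intro i j hij x hx
    exact Subtype.ext (comp_ne h i j hij x hx)
  · rw [eq_top_iff]
    intro x _
    obtain ⟨s, hs⟩ := sum_comp h (x : M)
    have : x = ∑ i ∈ s, (⟨comp h i x, hK i x x.2⟩ : K) := by
      apply Subtype.ext
      rw [AddSubgroup.val_finsetSum]
      exact hs
    rw [this]
    exact sum_mem fun i _ => AddSubgroup.mem_iSup_of_mem i (comp_mem h i x)

/-- The image of a grading under a surjection whose kernel contains the homogeneous components
of its elements is a grading. -/
theorem isInternal_map (h : DirectSum.IsInternal ℳ) {N : Type*} [AddCommGroup N] (f : M →+ N) (hf : Function.Surjective f)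
    (hK : ∀ i x, f x = 0 → f (comp h i x) = 0) :
    DirectSum.IsInternal fun i => (ℳ i).map f := by
  refine isInternal_of_components _
    (fun i => f.liftOfSurjective hf ⟨f.comp (comp h i), fun y hy => hK i y hy⟩) ?_ ?_ ?_
  · rintro i _ ⟨x, hx, rfl⟩
    rw [AddMonoidHom.liftOfRightInverse_comp_apply]
    exact congrArg f (comp_self h i x hx)
  · rintro i j hij _ ⟨x, hx, rfl⟩
    rw [AddMonoidHom.liftOfRightInverse_comp_apply]
    exact (congrArg f (comp_ne h i j hij x hx)).trans (map_zero f)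
  · rw [← AddSubgroup.map_iSup, iSup_eq_top h, AddSubgroup.map_top_of_surjective f hf]

theorem isInternal_prod (h : DirectSum.IsInternal ℳ) {N : Type*} [AddCommGroup N] {𝒩 : L → AddSubgroup N}
    (h' : DirectSum.IsInternal 𝒩) : DirectSum.IsInternal fun i => (ℳ i).prod (𝒩 i) := by
  refine isInternal_of_components _ (fun i => (comp h i).prodMap (comp h' i)) ?_ ?_ ?_
  · intro i x hx
    exact Prod.ext (comp_self h i _ hx.1) (comp_self h' i _ hx.2)
  · intro i j hij x hx
    exact Prod.ext (comp_ne h i j hij _ hx.1) (comp_ne h' i j hij _ hx.2)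
  · rw [eq_top_iff]
    rintro ⟨x, y⟩ -
    obtain ⟨s, hs⟩ := sum_comp h x
    obtain ⟨t, ht⟩ := sum_comp h' y
    have : (x, y) = ∑ i ∈ s, AddMonoidHom.inl M N (comp h i x) +
        ∑ i ∈ t, AddMonoidHom.inr M N (comp h' i y) := by
      rw [← map_sum, ← map_sum, ← hs, ← ht]
      simp
    rw [this]
    refine add_mem (sum_mem fun i _ => AddSubgroup.mem_iSup_of_mem i ⟨comp_mem h i x, zero_mem _⟩)
      (sum_mem fun i _ => AddSubgroup.mem_iSup_of_mem i ⟨zero_mem _, comp_mem h' i y⟩)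

theorem isInternal_shift {L : Type v} [AddCommGroup L] [DecidableEq L] {ℳ : L → AddSubgroup M}
    (h : DirectSum.IsInternal ℳ) (l : L) : DirectSum.IsInternal fun m => ℳ (l + m) := by
  refine isInternal_of_components _ (fun m => comp h (l + m)) ?_ ?_ ?_
  · intro m x hx
    exact comp_self h _ x hx
  · intro i j hij x hx
    exact comp_ne h _ _ (by simpa using hij) x hx
  · rw [← iSup_eq_top h]
    exact (Equiv.addLeft l).iSup_comp (g := ℳ)

end SubgroupGrading

/-! ### Finitely generated graded modules -/

section GradedModules

variable {L : Type v} [AddCommGroup L] [DecidableEq L] {A : Type u} [CommRing A]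

/-- A finitely generated `L`-graded module over a commutative ring `A` with grading `𝒜`. -/
structure GrMod (𝒜 : L → AddSubgroup A) where
  carrier : Type u
  [addCommGroup : AddCommGroup carrier]
  [module : Module A carrier]
  /-- The homogeneous elements of a given degree. -/
  gr : L → AddSubgroup carrier
  isInternal : DirectSum.IsInternal gr
  smul_mem : ∀ {i j : L} {a : A} {m : carrier}, a ∈ 𝒜 i → m ∈ gr j → a • m ∈ gr (i + j)
  finite : Module.Finite A carrier

namespace GrMod

variable {𝒜 : L → AddSubgroup A}

instance : CoeSort (GrMod 𝒜) (Type u) := ⟨GrMod.carrier⟩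

attribute [instance] GrMod.addCommGroup GrMod.module GrMod.finite

/-- Graded morphisms: the `A`-linear maps that preserve degrees. -/
@[ext]
structure Hom (M N : GrMod 𝒜) where
  toLin : M →ₗ[A] N
  map_mem : ∀ {i : L} {m : M}, m ∈ M.gr i → toLin m ∈ N.gr i

instance : Category (GrMod 𝒜) where
  Hom := Hom
  id M := ⟨LinearMap.id, fun h => h⟩
  comp f g := ⟨g.toLin.comp f.toLin, fun h => g.map_mem (f.map_mem h)⟩

@[ext]
theorem hom_ext {M N : GrMod 𝒜} {f g : M ⟶ N} (h : ∀ x, f.toLin x = g.toLin x) : f = g :=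
  Hom.ext (LinearMap.ext h)

@[simp] theorem id_apply (M : GrMod 𝒜) (x : M) : (𝟙 M : M ⟶ M).toLin x = x := rfl

@[simp] theorem comp_apply {M N P : GrMod 𝒜} (f : M ⟶ N) (g : N ⟶ P) (x : M) :
    (f ≫ g).toLin x = g.toLin (f.toLin x) := rfl

theorem toLin_injective (M N : GrMod 𝒜) :
    Function.Injective (fun f : M ⟶ N => f.toLin) := fun _ _ h => Hom.ext h

section Preadditive

variable (M N : GrMod 𝒜)

instance : Zero (M ⟶ N) := ⟨⟨0, fun _ => zero_mem _⟩⟩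
instance : Add (M ⟶ N) := ⟨fun f g => ⟨f.toLin + g.toLin, fun h =>
  add_mem (f.map_mem h) (g.map_mem h)⟩⟩
instance : Neg (M ⟶ N) := ⟨fun f => ⟨-f.toLin, fun h => neg_mem (f.map_mem h)⟩⟩
instance : Sub (M ⟶ N) := ⟨fun f g => ⟨f.toLin - g.toLin, fun h =>
  sub_mem (f.map_mem h) (g.map_mem h)⟩⟩
instance : SMul ℕ (M ⟶ N) := ⟨fun n f => ⟨n • f.toLin, fun h => nsmul_mem (f.map_mem h) n⟩⟩
instance : SMul ℤ (M ⟶ N) := ⟨fun n f => ⟨n • f.toLin, fun h => zsmul_mem (f.map_mem h) n⟩⟩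

instance : AddCommGroup (M ⟶ N) :=
  (toLin_injective M N).addCommGroup (fun f => f.toLin) rfl (fun _ _ => rfl) (fun _ => rfl)
    (fun _ _ => rfl) (fun _ _ => rfl) (fun _ _ => rfl)

end Preadditive

@[simp] theorem zero_apply {M N : GrMod 𝒜} (x : M) : (0 : M ⟶ N).toLin x = 0 := rfl

@[simp] theorem add_apply {M N : GrMod 𝒜} (f g : M ⟶ N) (x : M) :
    (f + g).toLin x = f.toLin x + g.toLin x := rfl

instance : Preadditive (GrMod 𝒜) where
  add_comp _ _ _ f f' g := by ext x; simp
  comp_add _ _ _ f g g' := by ext x; simp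

/-- The shift `M(l)` of the grading, with `M(l)_m = M_{l+m}`. -/
def shift (M : GrMod 𝒜) (l : L) : GrMod 𝒜 where
  carrier := M
  gr m := M.gr (l + m)
  isInternal := SubgroupGrading.isInternal_shift M.isInternal l
  smul_mem ha hm := by
    rw [add_left_comm]
    exact M.smul_mem ha hm
  finite := M.finite

theorem toLin_comp {M N : GrMod 𝒜} (f : M ⟶ N) (i : L) (x : M) :
    f.toLin (SubgroupGrading.comp M.isInternal i x) =
      SubgroupGrading.comp N.isInternal i (f.toLin x) :=
  (SubgroupGrading.comp_map M.isInternal N.isInternal f.toLin.toAddMonoidHom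
    (fun _ _ h => f.map_mem h) i x).symm

/-- Lift of a morphism along an injective one. -/
noncomputable def liftInj {K M N : GrMod 𝒜} (f : M ⟶ N) (hf : Function.Injective f.toLin)
    (g : K ⟶ N) (hg : ∀ x, ∃ y, f.toLin y = g.toLin x) : K ⟶ M where
  toLin :=
    { toFun := fun x => (hg x).choose
      map_add' := fun x y => hf ((hg (x + y)).choose_spec.trans (by
        rw [map_add, map_add, (hg x).choose_spec, (hg y).choose_spec]))
      map_smul' := fun a x => hf ((hg (a • x)).choose_spec.trans (by
        rw [RingHom.id_apply, map_smul, map_smul, (hg x).choose_spec])) }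
  map_mem {i x} hx := by
    have h : SubgroupGrading.comp M.isInternal i (hg x).choose = (hg x).choose := hf (by
      rw [toLin_comp, (hg x).choose_spec]
      exact SubgroupGrading.comp_self _ _ _ (g.map_mem hx))
    change (hg x).choose ∈ _
    rw [← h]
    exact SubgroupGrading.comp_mem _ _ _

theorem liftInj_comp {K M N : GrMod 𝒜} (f : M ⟶ N) (hf : Function.Injective f.toLin)
    (g : K ⟶ N) (hg : ∀ x, ∃ y, f.toLin y = g.toLin x) : liftInj f hf g hg ≫ f = g := by
  ext x
  exact (hg x).choose_spec

/-- Descent of a morphism along a surjective one. -/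
noncomputable def descSurj {M N P : GrMod 𝒜} (f : M ⟶ N) (hf : Function.Surjective f.toLin)
    (g : M ⟶ P) (hg : ∀ x, f.toLin x = 0 → g.toLin x = 0) : N ⟶ P where
  toLin :=
    have key : ∀ x y, f.toLin x = f.toLin y → g.toLin x = g.toLin y := fun x y h => by
      rw [← sub_eq_zero, ← map_sub]
      exact hg _ (by rw [map_sub, h, sub_self])
    { toFun := fun y => g.toLin (hf y).choose
      map_add' := fun x y => by
        rw [← map_add]
        apply key
        rw [map_add, (hf _).choose_spec, (hf _).choose_spec, (hf _).choose_spec]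
      map_smul' := fun a y => by
        rw [RingHom.id_apply, ← map_smul]
        apply key
        rw [map_smul, (hf _).choose_spec, (hf _).choose_spec] }
  map_mem {i y} hy := by
    change g.toLin (hf y).choose ∈ _
    have h : g.toLin (hf y).choose =
        g.toLin (SubgroupGrading.comp M.isInternal i (hf y).choose) := by
      rw [← sub_eq_zero, ← map_sub]
      apply hg
      rw [map_sub, toLin_comp, (hf y).choose_spec, SubgroupGrading.comp_self _ _ _ hy, sub_self]
    rw [h]
    exact g.map_mem (SubgroupGrading.comp_mem _ _ _)

theorem comp_descSurj {M N P : GrMod 𝒜} (f : M ⟶ N) (hf : Function.Surjective f.toLin)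
    (g : M ⟶ P) (hg : ∀ x, f.toLin x = 0 → g.toLin x = 0) : f ≫ descSurj f hf g hg = g := by
  ext x
  change g.toLin (hf (f.toLin x)).choose = g.toLin x
  rw [← sub_eq_zero, ← map_sub]
  apply hg
  rw [map_sub, (hf _).choose_spec, sub_self]

/-- The kernel of a graded morphism. -/
def ker [IsNoetherianRing A] {M N : GrMod 𝒜} (f : M ⟶ N) : GrMod 𝒜 where
  carrier := LinearMap.ker f.toLin
  gr i := (M.gr i).comap (LinearMap.ker f.toLin).toAddSubgroup.subtype
  isInternal := SubgroupGrading.isInternal_comap M.isInternal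
    (LinearMap.ker f.toLin).toAddSubgroup fun i x hx => by
      change f.toLin _ = 0
      rw [toLin_comp, show f.toLin x = 0 from hx, map_zero]
  smul_mem ha hm := M.smul_mem ha hm
  finite := inferInstance

/-- The inclusion of the kernel. -/
def kerι [IsNoetherianRing A] {M N : GrMod 𝒜} (f : M ⟶ N) : ker f ⟶ M where
  toLin := (LinearMap.ker f.toLin).subtype
  map_mem h := h

/-- The cokernel of a graded morphism. -/
def coker {M N : GrMod 𝒜} (f : M ⟶ N) : GrMod 𝒜 where
  carrier := N ⧸ LinearMap.range f.toLin
  gr i := (N.gr i).map (LinearMap.range f.toLin).mkQ.toAddMonoidHom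
  isInternal := SubgroupGrading.isInternal_map N.isInternal _
    (Submodule.mkQ_surjective _) fun i x hx => by
      obtain ⟨y, rfl⟩ := (Submodule.Quotient.mk_eq_zero _).1 hx
      exact (Submodule.Quotient.mk_eq_zero _).2 ⟨_, toLin_comp f i y⟩
  smul_mem := by
    rintro i j a _ ha ⟨x, hx, rfl⟩
    exact ⟨a • x, N.smul_mem ha hx, (LinearMap.range f.toLin).mkQ.map_smul a x⟩
  finite := inferInstance

/-- The projection to the cokernel. -/
def cokerπ {M N : GrMod 𝒜} (f : M ⟶ N) : N ⟶ coker f where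
  toLin := (LinearMap.range f.toLin).mkQ
  map_mem {_ m} h := ⟨m, h, rfl⟩

theorem cokerπ_surjective {M N : GrMod 𝒜} (f : M ⟶ N) :
    Function.Surjective (cokerπ f).toLin := Submodule.mkQ_surjective _

theorem cokerπ_eq_zero_iff {M N : GrMod 𝒜} (f : M ⟶ N) (x : N) :
    (cokerπ f).toLin x = 0 ↔ ∃ y, f.toLin y = x :=
  Submodule.Quotient.mk_eq_zero _

theorem apply_apply_of_comp {M N P : GrMod 𝒜} {f : M ⟶ N} {g : N ⟶ P} (h : f ≫ g = 0) (x : M) :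
    g.toLin (f.toLin x) = 0 := by
  rw [← comp_apply, h, zero_apply]

/-- An injective morphism with range the kernel of `g` is a kernel of `g`. -/
noncomputable def isLimitOfInjective {M N P : GrMod 𝒜} (f : M ⟶ N) (g : N ⟶ P)
    (hf : Function.Injective f.toLin) (w : f ≫ g = 0)
    (hex : ∀ x, g.toLin x = 0 → ∃ y, f.toLin y = x) : IsLimit (KernelFork.ofι f w) :=
  KernelFork.IsLimit.ofι f w
    (fun k hk => liftInj f hf k fun x => hex _ (apply_apply_of_comp hk x))
    (fun k hk => liftInj_comp f hf k _)
    (fun k hk b hb => by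
      ext x
      apply hf
      rw [← comp_apply, ← comp_apply, hb, liftInj_comp])

/-- A surjective morphism with kernel the range of `f` is a cokernel of `f`. -/
noncomputable def isColimitOfSurjective {M N P : GrMod 𝒜} (f : M ⟶ N) (g : N ⟶ P)
    (hg : Function.Surjective g.toLin) (w : f ≫ g = 0)
    (hex : ∀ x, g.toLin x = 0 → ∃ y, f.toLin y = x) : IsColimit (CokernelCofork.ofπ g w) :=
  have key : ∀ {Z : GrMod 𝒜} (k : N ⟶ Z) (_ : f ≫ k = 0) (x : N), g.toLin x = 0 →
      k.toLin x = 0 := fun k hk x hx => by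
    obtain ⟨y, rfl⟩ := hex x hx
    exact apply_apply_of_comp hk y
  CokernelCofork.IsColimit.ofπ g w
    (fun k hk => descSurj g hg k (key k hk))
    (fun k hk => comp_descSurj g hg k _)
    (fun k hk b hb => by
      ext x
      obtain ⟨x, rfl⟩ := hg x
      rw [← comp_apply, ← comp_apply, hb, comp_descSurj])

theorem kerι_comp [IsNoetherianRing A] {M N : GrMod 𝒜} (f : M ⟶ N) : kerι f ≫ f = 0 := by
  ext x
  exact x.2

theorem comp_cokerπ {M N : GrMod 𝒜} (f : M ⟶ N) : f ≫ cokerπ f = 0 := by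
  ext x
  exact (cokerπ_eq_zero_iff f _).2 ⟨x, rfl⟩

instance [IsNoetherianRing A] : HasKernels (GrMod 𝒜) where
  has_limit f := ⟨⟨⟨_, isLimitOfInjective (kerι f) f Subtype.val_injective (kerι_comp f)
    fun x hx => ⟨⟨x, hx⟩, rfl⟩⟩⟩⟩

instance : HasCokernels (GrMod 𝒜) where
  has_colimit f := ⟨⟨⟨_, isColimitOfSurjective f (cokerπ f) (cokerπ_surjective f) (comp_cokerπ f)
    fun x hx => (cokerπ_eq_zero_iff f x).1 hx⟩⟩⟩

theorem injective_of_mono [IsNoetherianRing A] {M N : GrMod 𝒜} (f : M ⟶ N) [Mono f] :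
    Function.Injective f.toLin := by
  rw [← LinearMap.ker_eq_bot, Submodule.eq_bot_iff]
  intro x hx
  have h : kerι f = 0 := by
    rw [← cancel_mono f, kerι_comp, zero_comp]
  have := congrArg (fun k : ker f ⟶ M => k.toLin ⟨x, hx⟩) h
  exact this

theorem surjective_of_epi {M N : GrMod 𝒜} (f : M ⟶ N) [Epi f] :
    Function.Surjective f.toLin := by
  intro x
  have h : cokerπ f = 0 := by
    rw [← cancel_epi f, comp_cokerπ, comp_zero]
  exact (cokerπ_eq_zero_iff f x).1 (by rw [h, zero_apply])

instance [IsNoetherianRing A] : IsNormalMonoCategory (GrMod 𝒜) where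
  normalMonoOfMono f _ := ⟨⟨_, cokerπ f, comp_cokerπ f,
    isLimitOfInjective f (cokerπ f) (injective_of_mono f) (comp_cokerπ f)
      fun x hx => (cokerπ_eq_zero_iff f x).1 hx⟩⟩

instance [IsNoetherianRing A] : IsNormalEpiCategory (GrMod 𝒜) where
  normalEpiOfEpi f _ := ⟨⟨_, kerι f, kerι_comp f,
    isColimitOfSurjective (kerι f) f (surjective_of_epi f) (kerι_comp f)
      fun x hx => ⟨⟨x, hx⟩, rfl⟩⟩⟩

/-- The zero module. -/
def zeroObj (𝒜 : L → AddSubgroup A) : GrMod 𝒜 where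
  carrier := PUnit
  gr _ := ⊤
  isInternal := SubgroupGrading.isInternal_of_components _ (fun _ => 0)
    (fun _ _ _ => rfl) (fun _ _ _ _ _ => rfl)
    (eq_top_iff.2 fun x _ => by
      rw [Subsingleton.elim x 0]
      exact zero_mem _)
  smul_mem _ _ := AddSubgroup.mem_top _
  finite := inferInstance

/-- The direct sum of two graded modules. -/
def prod (M N : GrMod 𝒜) : GrMod 𝒜 where
  carrier := M × N
  gr i := (M.gr i).prod (N.gr i)
  isInternal := SubgroupGrading.isInternal_prod M.isInternal N.isInternal
  smul_mem ha hm := ⟨M.smul_mem ha hm.1, N.smul_mem ha hm.2⟩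
  finite := inferInstance

instance : HasZeroObject (GrMod 𝒜) :=
  ⟨zeroObj 𝒜, (IsZero.iff_id_eq_zero _).2 (by ext x; rfl)⟩

/-- The bicone exhibiting `M × N` as a biproduct. -/
def prodBicone (M N : GrMod 𝒜) : BinaryBicone M N where
  pt := prod M N
  fst := ⟨LinearMap.fst A M N, fun h => h.1⟩
  snd := ⟨LinearMap.snd A M N, fun h => h.2⟩
  inl := ⟨LinearMap.inl A M N, fun h => ⟨h, zero_mem _⟩⟩
  inr := ⟨LinearMap.inr A M N, fun h => ⟨zero_mem _, h⟩⟩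

instance : HasBinaryBiproducts (GrMod 𝒜) where
  has_binary_biproduct M N := hasBinaryBiproduct_of_total (prodBicone M N) (by
    ext x
    change ((x.1, 0) : M × N) + ((0, x.2) : M × N) = x
    rw [Prod.mk_add_mk, add_zero, zero_add]
    rfl)

instance : HasFiniteProducts (GrMod 𝒜) := hasFiniteProducts_of_has_binary_and_terminal

noncomputable instance [IsNoetherianRing A] : Abelian (GrMod 𝒜) where

noncomputable instance [IsNoetherianRing A] : HasDerivedCategory.{max v (u + 1)} (GrMod 𝒜) :=
  HasDerivedCategory.standard _

end GrMod

end GradedModules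

/-! ### Perfect complexes and the category of singularities -/

section Perfect

variable (C : Type*) [Category* C] [Abelian C]

open DerivedCategory
open scoped ZeroObject

variable {C} in
theorem mappingCone_bounded_projective {K L : CochainComplex C ℤ} (f : K ⟶ L)
    (hK : ∃ a b : ℤ, K.IsStrictlyGE a ∧ K.IsStrictlyLE b)
    (hL : ∃ a b : ℤ, L.IsStrictlyGE a ∧ L.IsStrictlyLE b)
    (pK : ∀ i, Projective (K.X i)) (pL : ∀ i, Projective (L.X i)) :
    ∃ a b : ℤ, (CochainComplex.mappingCone f).IsStrictlyGE a ∧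
      (CochainComplex.mappingCone f).IsStrictlyLE b ∧
      ∀ i, Projective ((CochainComplex.mappingCone f).X i) := by
  obtain ⟨a, b, ha, hb⟩ := hK
  obtain ⟨a', b', ha', hb'⟩ := hL
  refine ⟨min (a - 1) a', max b b', ?_, ?_, fun i => ?_⟩
  · rw [CochainComplex.isStrictlyGE_iff]
    intro i hi
    rw [CochainComplex.mappingCone.isZero_X_iff]
    exact ⟨K.isZero_of_isStrictlyGE a _ (by lia), L.isZero_of_isStrictlyGE a' _ (by lia)⟩
  · rw [CochainComplex.isStrictlyLE_iff]
    intro i hi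
    rw [CochainComplex.mappingCone.isZero_X_iff]
    exact ⟨K.isZero_of_isStrictlyLE b _ (by lia), L.isZero_of_isStrictlyLE b' _ (by lia)⟩
  · have := pK (i + 1)
    have := pL i
    exact Projective.of_iso (HomologicalComplex.homotopyCofiber.XIsoBiprod f i (i + 1) rfl).symm
      inferInstance

variable [HasDerivedCategory C]

/-- Perfect objects of the bounded derived category: those isomorphic to (the image of)
a bounded complex of projective objects. -/
def perfect : ObjectProperty (DerivedCategory.Bounded C) := fun X =>
  ∃ (K : CochainComplex C ℤ) (a b : ℤ), K.IsStrictlyGE a ∧ K.IsStrictlyLE b ∧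
    (∀ i, Projective (K.X i)) ∧ Nonempty (X.obj ≅ DerivedCategory.Q.obj K)

variable {C}

theorem perfect_of_iso {X Y : DerivedCategory.Bounded C} (e : X ≅ Y) (h : perfect C X) :
    perfect C Y := by
  obtain ⟨K, a, b, ha, hb, hK, ⟨e'⟩⟩ := h
  exact ⟨K, a, b, ha, hb, hK, ⟨(DerivedCategory.Bounded.ι.mapIso e).symm ≪≫ e'⟩⟩

instance : (perfect C).IsClosedUnderIsomorphisms := ⟨fun e h => perfect_of_iso e h⟩

instance : (perfect C).ContainsZero where
  exists_zero := by
    refine ⟨0, isZero_zero _, 0, 0, 0, ?_, ?_, ?_, ⟨?_⟩⟩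
    · rw [CochainComplex.isStrictlyGE_iff]
      exact fun i _ => (HomologicalComplex.eval C _ i).map_isZero (isZero_zero _)
    · rw [CochainComplex.isStrictlyLE_iff]
      exact fun i _ => (HomologicalComplex.eval C _ i).map_isZero (isZero_zero _)
    · intro i
      exact Projective.of_iso ((isZero_zero C).iso
        ((HomologicalComplex.eval C (ComplexShape.up ℤ) i).map_isZero (isZero_zero _))) inferInstance
    · exact IsZero.iso (DerivedCategory.Bounded.ι.map_isZero (isZero_zero _))
        (DerivedCategory.Q.map_isZero (isZero_zero _))

instance : (perfect C).IsStableUnderShift ℤ where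
  isStableUnderShiftBy n := ⟨by
    rintro X ⟨K, a, b, ha, hb, hK, ⟨e⟩⟩
    refine ⟨K⟦n⟧, a - n, b - n, K.isStrictlyGE_shift a n _ (by lia),
      K.isStrictlyLE_shift b n _ (by lia), fun i => hK _, ⟨?_⟩⟩
    exact (DerivedCategory.Bounded.ι.commShiftIso n).app X ≪≫
      (shiftFunctor (DerivedCategory C) n).mapIso e ≪≫
      (DerivedCategory.Q.commShiftIso n).symm.app K⟩

theorem exists_chainMap {K L : CochainComplex C ℤ} [K.IsKProjective]
    (f : DerivedCategory.Q.obj K ⟶ DerivedCategory.Q.obj L) :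
    ∃ g : K ⟶ L, DerivedCategory.Q.map g = f := by
  obtain ⟨h, hh⟩ := (CochainComplex.IsKProjective.Qh_map_bijective K
    ((HomotopyCategory.quotient _ _).obj L)).2
    ((quotientCompQhIso C).hom.app K ≫ f ≫ (quotientCompQhIso C).inv.app L)
  obtain ⟨g, rfl⟩ := (HomotopyCategory.quotient _ _).map_surjective h
  refine ⟨g, ?_⟩
  have := quotientCompQhIso_hom_naturality g
  rw [← cancel_epi ((quotientCompQhIso C).hom.app K), ← this, hh]
  simp

instance : (perfect C).IsTriangulatedClosed₃ :=
  ObjectProperty.IsTriangulatedClosed₃.mk' (by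
    rintro T hT ⟨K, a, b, ha, hb, pK, ⟨e⟩⟩ ⟨L, a', b', ha', hb', pL, ⟨e'⟩⟩
    have : K.IsKProjective := CochainComplex.isKProjective_of_projective K b
    obtain ⟨g, hg⟩ := exists_chainMap (e.inv ≫ DerivedCategory.Bounded.ι.map T.mor₁ ≫ e'.hom)
    obtain ⟨c, d, hc, hd, hp⟩ :=
      mappingCone_bounded_projective g ⟨a, b, ha, hb⟩ ⟨a', b', ha', hb'⟩ pK pL
    exact ⟨_, c, d, hc, hd, hp, ⟨Pretriangulated.Triangle.π₃.mapIso
      (Pretriangulated.isoTriangleOfIso₁₂ _ _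
        (DerivedCategory.Bounded.ι.map_distinguished T hT)
        (DerivedCategory.mappingCone_triangle_distinguished g) e e' (by
          change DerivedCategory.Bounded.ι.map T.mor₁ ≫ e'.hom = e.hom ≫ DerivedCategory.Q.map g
          rw [hg, Iso.hom_inv_id_assoc]))⟩⟩)

instance : (perfect C).IsTriangulated where
  toIsTriangulatedClosed₂ := .of_isTriangulatedClosed₃

end Perfect

section Singularities

variable {L : Type v} [AddCommGroup L] [DecidableEq L] {A : Type u} [CommRing A]
  [IsNoetherianRing A] (𝒜 : L → AddSubgroup A)

/-- The bounded derived category of finitely generated `L`-graded `A`-modules. -/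
abbrev Db : Type _ := DerivedCategory.Bounded (GrMod 𝒜)

/-- The graded category of singularities: the Verdier quotient of the bounded derived category by
the perfect complexes, i.e. its localization at the morphisms whose cone is perfect. -/
abbrev Dsg : Type _ := (perfect (GrMod 𝒜)).trW.Localization

/-- The functor sending a module to the complex concentrated in degree zero. -/
noncomputable abbrev moduleToDb : GrMod 𝒜 ⥤ Db 𝒜 :=
  DerivedCategory.TStructure.t.bounded.lift (DerivedCategory.singleFunctor (GrMod 𝒜) 0)
    fun _ => ⟨⟨0, inferInstance⟩, ⟨0, inferInstance⟩⟩

/-- The quotient functor. -/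
noncomputable abbrev dbToDsg : Db 𝒜 ⥤ Dsg 𝒜 := (perfect (GrMod 𝒜)).trW.Q

end Singularities

/-! ### Quotients of graded rings -/

section QuotientGrading

variable {L : Type v} {R : Type u} [CommRing R]

/-- The grading induced on `R ⧸ I`: its homogeneous elements of degree `l` are the classes of those
of `R`. -/
def quotientGrading (𝓡 : L → AddSubgroup R) (I : Ideal R) : L → AddSubgroup (R ⧸ I) :=
  fun l => (𝓡 l).map (Ideal.Quotient.mk I).toAddMonoidHom

/-- When `I` is homogeneous this is a grading. -/
theorem quotientGrading_gradedRing [AddCommGroup L] [DecidableEq L] (𝓡 : L → AddSubgroup R)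
    [GradedRing 𝓡] (I : Ideal R) (hI : I.IsHomogeneous 𝓡) :
    Nonempty (GradedRing (quotientGrading 𝓡 I)) := by
  have h : DirectSum.IsInternal 𝓡 := DirectSum.Decomposition.isInternal 𝓡
  have h' : DirectSum.IsInternal (quotientGrading 𝓡 I) :=
    SubgroupGrading.isInternal_map h _ Ideal.Quotient.mk_surjective fun i x hx => by
      refine Ideal.Quotient.eq_zero_iff_mem.2 ?_
      have hx' := hI i (Ideal.Quotient.eq_zero_iff_mem.1 hx)
      have e := SubgroupGrading.comp_coe h i (DirectSum.decompose 𝓡 x)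
      rw [show DirectSum.coeAddMonoidHom 𝓡 (DirectSum.decompose 𝓡 x) = x from
        DirectSum.Decomposition.left_inv x] at e
      rwa [e]
  exact ⟨{
    one_mem := ⟨1, SetLike.GradedOne.one_mem, map_one (Ideal.Quotient.mk I)⟩
    mul_mem := by
      rintro i j _ _ ⟨x, hx, rfl⟩ ⟨y, hy, rfl⟩
      exact ⟨x * y, SetLike.GradedMul.mul_mem hx hy, map_mul (Ideal.Quotient.mk I) x y⟩
    toDecomposition := h'.chooseDecomposition }⟩

end QuotientGrading

/-!
Let `A = R ⧸ (w)`. The isomorphism is the composite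
`Hom_sg(M, N[i]) ≅ Hom_sg(M, N(-jd)[i + 2j]) ≅ Hom(M, N(-jd)[i + 2j])`
of a periodicity isomorphism and the inverse of the map induced by the quotient functor. The
condition on `j` says that `i + 2j ≥ n`. Naturality in `M` is clear, as the first isomorphism is
the composition with a fixed isomorphism and the second comes from a functor.

*Periodicity.* Present `N` over `R` as `F / K` with `F` graded free. Since `w F ⊆ K` and `w` is
regular on `F`, there is an exact sequence `0 → N(-d) → K / w K → F / w F → N → 0` of graded
`A`-modules, where `N(-d)` is `w F / w K` (`GrMod.exists_periodicity_sequences`). The module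
`F / w F` is free. As `R` is regular of finite dimension, `K` has finite projective dimension over
`R` (`IsRegularRing.hasProjectiveDimensionLE`), so `K / w K` has finite projective dimension over
`A`. Hence both middle terms are perfect, and `N ≅ N(-d)[2]` in the category of singularities.

*Comparison.* A morphism from a perfect complex to `N[k]` factors through a bounded complex of
projectives in degrees `≤ -k`, by truncation. If `Ext` from `M` to projectives vanishes in degrees
`≥ k`, then `M` has no nonzero morphisms to such a complex or to its shift, and the calculus of
fractions shows that morphisms `M → N[k]` are unchanged in the Verdier quotient
(`CategoryTheory.ObjectProperty.trW_Q_map_bijective`).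

*Vanishing of `Ext`.* A module `M` over `A` has projective dimension at most `n` over `R`. Shifting
dimensions along graded free covers over `A` reduces the vanishing of `Ext` to projectives in
degrees `≥ max(1, n)` to the case of projective dimension one over `R`. There a map to a projective
is extended by lifting it to a free `R`-module and dividing by `w` (`exists_linearMap_extension`),
and the extension can be made homogeneous by passing to its degree zero component. If `n = 0`, all
`A`-modules vanish.
-/

/-! ### Regular local rings -/

section RegularLocalRings

open IsLocalRing

namespace IsLocalRing

variable {R : Type u} [CommRing R] [IsLocalRing R] [IsNoetherianRing R]

/-- Killing an element of `𝔪 ∖ 𝔪²` lowers the embedding dimension: the class of `x` in the cotangent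
space can be completed to a basis. -/
theorem spanFinrank_maximalIdeal_quotient_succ_le {x : R} (hx : x ∈ maximalIdeal R)
    (hx2 : x ∉ maximalIdeal R ^ 2) [IsLocalRing (R ⧸ Ideal.span {x})] :
    (maximalIdeal (R ⧸ Ideal.span {x})).spanFinrank + 1 ≤ (maximalIdeal R).spanFinrank := by
  rw [spanFinrank_maximalIdeal_eq_finrank_cotangentSpace R]
  let v : CotangentSpace R := (maximalIdeal R).toCotangent ⟨x, hx⟩
  have hv : v ≠ 0 := fun h => hx2 (((maximalIdeal R).toCotangent_eq_zero _).1 h)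
  obtain ⟨W, hW⟩ := Submodule.exists_isCompl (ResidueField R ∙ v)
  have hfin := Submodule.finrank_add_eq_of_isCompl hW
  rw [finrank_span_singleton hv] at hfin
  let b := Module.finBasis (ResidueField R) W
  choose y hy using fun i => (maximalIdeal R).toCotangent_surjective (b i : CotangentSpace R)
  have hspan : Submodule.span R (insert ⟨x, hx⟩ (Set.range y)) = ⊤ := by
    rw [← CotangentSpace.span_image_eq_top_iff, Set.image_insert_eq, ← Set.range_comp,
      Submodule.span_insert]
    have : Set.range ((maximalIdeal R).toCotangent ∘ y) = W.subtype '' Set.range b := by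
      rw [← Set.range_comp]
      exact congrArg Set.range (funext hy)
    rw [this, Submodule.span_image, b.span_eq, Submodule.map_top, Submodule.range_subtype]
    exact hW.sup_eq_top
  have hm : maximalIdeal R = Ideal.span (insert x (Set.range fun i => (y i : R))) := by
    have := congrArg (Submodule.map (maximalIdeal R).subtype) hspan
    rw [Submodule.map_top, Submodule.range_subtype, Submodule.map_span, Set.image_insert_eq,
      ← Set.range_comp] at this
    exact this.symm
  have hq : maximalIdeal (R ⧸ Ideal.span {x}) =
      Ideal.span (Set.range fun i => Ideal.Quotient.mk (Ideal.span {x}) (y i)) := by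
    rw [← map_maximalIdeal_of_surjective (Ideal.Quotient.mk (Ideal.span {x}))
      Ideal.Quotient.mk_surjective]
    refine (congrArg (Ideal.map _) hm).trans ?_
    rw [Ideal.map_span, Set.image_insert_eq,
      Ideal.Quotient.eq_zero_iff_mem.2 (Ideal.mem_span_singleton_self x), ← Set.range_comp]
    exact Submodule.span_insert_zero
  have hle := Submodule.spanFinrank_span_le_ncard_of_finite (R := R ⧸ Ideal.span {x})
    (Set.finite_range fun i => Ideal.Quotient.mk (Ideal.span {x}) (y i))
  have hcard : (Set.range fun i => Ideal.Quotient.mk (Ideal.span {x}) (y i)).ncard ≤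
      Module.finrank (ResidueField R) W := by
    rw [← Set.image_univ]
    refine (Set.ncard_image_le Set.finite_univ).trans ?_
    rw [Set.ncard_univ, Nat.card_eq_fintype_card, Fintype.card_fin]
  rw [hq, ← hfin, add_comm 1]
  exact Nat.succ_le_succ (hle.trans hcard)

end IsLocalRing

namespace IsRegularLocalRing

/-- The quotient of a regular local ring by an element of `𝔪 ∖ 𝔪²` is regular of one dimension
less: the embedding dimension drops by at least one, the Krull dimension by at most one. -/
theorem quotient_span_singleton {R : Type u} [CommRing R] [IsRegularLocalRing R] {x : R}
    (hx : x ∈ maximalIdeal R) (hx2 : x ∉ maximalIdeal R ^ 2) :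
    IsRegularLocalRing (R ⧸ Ideal.span {x}) ∧
      ringKrullDim (R ⧸ Ideal.span {x}) + 1 = ringKrullDim R := by
  have hne : Ideal.span {x} ≠ ⊤ := fun h =>
    (maximalIdeal.isMaximal R).ne_top (top_le_iff.1 (h ▸ (Ideal.span_singleton_le_iff_mem _).2 hx))
  have : Nontrivial (R ⧸ Ideal.span {x}) := Ideal.Quotient.nontrivial_iff.2 hne
  have : IsLocalRing (R ⧸ Ideal.span {x}) :=
    .of_surjective' (Ideal.Quotient.mk _) Ideal.Quotient.mk_surjective
  have h1 := spanFinrank_maximalIdeal_quotient_succ_le hx hx2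
  have h2 := ringKrullDim_le_ringKrullDim_quotSMulTop_succ hx
  rw [← Submodule.ideal_span_singleton_smul, smul_eq_mul, Ideal.mul_top] at h2
  have h3 := (isRegularLocalRing_iff R).1 inferInstance
  have h4 := ringKrullDim_le_spanFinrank_maximalIdeal (R ⧸ Ideal.span {x})
  have h1' : ((maximalIdeal (R ⧸ Ideal.span {x})).spanFinrank : WithBot ℕ∞) + 1 ≤
    (maximalIdeal R).spanFinrank := by exact_mod_cast h1
  have h5 : ringKrullDim (R ⧸ Ideal.span {x}) + 1 = ringKrullDim R :=
    le_antisymm ((add_le_add_left h4 1).trans (h1'.trans h3.le)) h2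
  refine ⟨.of_spanFinrank_maximalIdeal_le _ ?_, h5⟩
  rw [h3, ← h5] at h1'
  exact (ENat.WithBot.add_le_add_one_right_iff).1 h1'

theorem not_maximalIdeal_le_sq {R : Type u} [CommRing R] [IsRegularLocalRing R]
    (h : maximalIdeal R ≠ ⊥) : ¬ maximalIdeal R ≤ maximalIdeal R ^ 2 := fun hle => by
  have hid : IsIdempotentElem (maximalIdeal R) :=
    le_antisymm Ideal.mul_le_right (by rwa [← pow_two])
  rw [Ideal.isIdempotentElem_iff_eq_bot_or_top_of_isLocalRing] at hid
  exact hid.elim h (maximalIdeal.isMaximal R).ne_top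

theorem maximalIdeal_eq_bot_iff {R : Type u} [CommRing R] [IsRegularLocalRing R] :
    maximalIdeal R = ⊥ ↔ ringKrullDim R = 0 := by
  rw [← (isRegularLocalRing_iff R).1 inferInstance,
    ← Submodule.spanFinrank_eq_zero_iff_eq_bot (maximalIdeal R).fg_of_isNoetherianRing]
  exact Nat.cast_eq_zero.symm

/-- Regular local rings are domains. In the induction step `x ∈ 𝔪 ∖ 𝔪²` is chosen outside all the
minimal primes. The quotient by `x` is a domain, so `(x)` is prime and contains a minimal prime `P`;
as `x ∉ P`, one has `P = x P`, and `P = 0` by Nakayama's lemma. -/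
theorem isDomain_of_ringKrullDim_eq (n : ℕ) : ∀ (R : Type u) [CommRing R] [IsRegularLocalRing R],
    ringKrullDim R = n → IsDomain R := by
  induction n with
  | zero =>
    intro R _ _ h
    exact (isField_iff_maximalIdeal_eq.2 (maximalIdeal_eq_bot_iff.2 h)).isDomain
  | succ n ih =>
    intro R _ _ hdim
    have hbot : maximalIdeal R ≠ ⊥ := by
      rw [Ne, maximalIdeal_eq_bot_iff, hdim]
      exact_mod_cast Nat.succ_ne_zero n
    -- Prime avoidance tolerates the ideal `𝔪²`, since up to two of the ideals need not be prime.
    have hnot : ¬ ((maximalIdeal R : Set R) ⊆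
        ⋃ I ∈ insert (maximalIdeal R ^ 2) (minimalPrimes R), ((id I : Ideal R) : Set R)) := by
      rw [Ideal.subset_union_prime_finite (f := id)
        ((minimalPrimes.finite_of_isNoetherianRing R).insert _)
        (maximalIdeal R ^ 2) (maximalIdeal R ^ 2) (fun i hi h1 _ => (hi.resolve_left h1).1.1)]
      rintro ⟨I, rfl | hI, hle⟩
      · exact not_maximalIdeal_le_sq hbot hle
      · obtain rfl : maximalIdeal R = I := le_antisymm hle (le_maximalIdeal hI.1.1.ne_top)
        have := maximalIdeal_height_eq_ringKrullDim (R := R)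
        rw [Ideal.height_eq_zero_iff.2 hI, hdim] at this
        exact absurd this (by exact_mod_cast (Nat.succ_ne_zero n).symm)
    obtain ⟨x, hx, hx'⟩ := Set.not_subset.1 hnot
    simp only [Set.mem_iUnion, not_exists, id, SetLike.mem_coe] at hx'
    have hx2 := hx' _ (Set.mem_insert _ _)
    obtain ⟨_, hd⟩ := quotient_span_singleton hx hx2
    have : IsDomain (R ⧸ Ideal.span {x}) := ih _ (by
      rw [hdim, Nat.cast_succ] at hd
      exact le_antisymm (ENat.WithBot.add_le_add_one_right_iff.1 hd.le)
        (ENat.WithBot.add_le_add_one_right_iff.1 hd.ge))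
    have hp : (Ideal.span {x}).IsPrime := (Ideal.Quotient.isDomain_iff_prime _).1 this
    obtain ⟨P, hP, hle⟩ := Ideal.exists_minimalPrimes_le (bot_le : ⊥ ≤ Ideal.span {x})
    have hPp : P.IsPrime := hP.1.1
    have hPbot : P = ⊥ := by
      refine Submodule.eq_bot_of_le_smul_of_le_jacobson_bot (maximalIdeal R) P
        P.fg_of_isNoetherianRing (fun p hp => ?_) (jacobson_eq_maximalIdeal _ bot_ne_top).ge
      obtain ⟨a, rfl⟩ := Ideal.mem_span_singleton'.1 (hle hp)
      rw [mul_comm]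
      exact Submodule.smul_mem_smul hx ((hPp.mem_or_mem hp).resolve_right
        (hx' P (Set.mem_insert_of_mem _ hP)))
    subst hPbot
    exact IsDomain.of_bot_isPrime R

instance (priority := low) {R : Type u} [CommRing R] [IsRegularLocalRing R] : IsDomain R :=
  isDomain_of_ringKrullDim_eq (maximalIdeal R).spanFinrank R
    ((isRegularLocalRing_iff R).1 inferInstance).symm

end IsRegularLocalRing

end RegularLocalRings

/-! ### Projective dimension over regular rings -/

section RegularRings

open IsLocalRing

section ProjectiveDimension

variable {R : Type u} [CommRing R]

theorem ModuleCat.hasProjectiveDimensionLE_zero_iff (M : Type u) [AddCommGroup M] [Module R M] :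
    HasProjectiveDimensionLE (ModuleCat.of R M) 0 ↔ Module.Projective R M := by
  rw [← projective_iff_hasProjectiveDimensionLE_zero, ← IsProjective.iff_projective]

/-- Dimension shifting along a short exact sequence with projective middle term. -/
theorem ModuleCat.hasProjectiveDimensionLE_iff_of_exact {K P M : Type u} [AddCommGroup K]
    [Module R K] [AddCommGroup P] [Module R P] [AddCommGroup M] [Module R M] [Module.Projective R P]
    (f : K →ₗ[R] P) (g : P →ₗ[R] M) (hf : Function.Injective f) (hfg : Function.Exact f g)
    (hg : Function.Surjective g) (m : ℕ) :
    HasProjectiveDimensionLE (ModuleCat.of R M) (m + 1) ↔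
      HasProjectiveDimensionLE (ModuleCat.of R K) m := by
  have : Projective (ModuleCat.of R P) := (IsProjective.iff_projective (R := R) P).1 inferInstance
  exact (ModuleCat.shortComplex_shortExact
    (ModuleCat.shortComplexOfCompEqZero f g hfg.linearMap_comp_eq_zero)
    hfg hf hg).hasProjectiveDimensionLT_X₃_iff m this

/-- Dimension shifting along the kernel of a surjection from a projective module. -/
theorem ModuleCat.hasProjectiveDimensionLE_ker_iff {P M : Type u} [AddCommGroup P] [Module R P]
    [AddCommGroup M] [Module R M] [Module.Projective R P] (g : P →ₗ[R] M)
    (hg : Function.Surjective g) (m : ℕ) :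
    HasProjectiveDimensionLE (ModuleCat.of R M) (m + 1) ↔
      HasProjectiveDimensionLE (ModuleCat.of R (LinearMap.ker g)) m :=
  hasProjectiveDimensionLE_iff_of_exact _ g (LinearMap.ker g).injective_subtype
    g.exact_subtype_ker_map hg m

instance Module.Projective.quotSMulTop (x : R) (P : Type u) [AddCommGroup P] [Module R P]
    [Module.Projective R P] : Module.Projective (R ⧸ Ideal.span {x}) (QuotSMulTop x P) :=
  Module.Projective.of_equiv ((QuotSMulTop.equivQuotTensor x P).extendScalarsOfSurjective
    Ideal.Quotient.mk_surjective).symm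

/-- For `x` regular on `M`, the kernel of `P / x P → M / x M` is `K / x K`, where `K` is the kernel
of `P → M`. -/
theorem ModuleCat.hasProjectiveDimensionLE_quotSMulTop_ker_iff {P M : Type u} [AddCommGroup P]
    [Module R P] [AddCommGroup M] [Module R M] [Module.Projective R P] (g : P →ₗ[R] M)
    (hg : Function.Surjective g) (x : R) (hx : IsSMulRegular M x) (m : ℕ) :
    HasProjectiveDimensionLE (ModuleCat.of (R ⧸ Ideal.span {x}) (QuotSMulTop x M)) (m + 1) ↔
      HasProjectiveDimensionLE
        (ModuleCat.of (R ⧸ Ideal.span {x}) (QuotSMulTop x (LinearMap.ker g))) m := by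
  let A := R ⧸ Ideal.span {x}
  have hsurj : Function.Surjective (algebraMap R A) := Ideal.Quotient.mk_surjective
  let f' : QuotSMulTop x (LinearMap.ker g) →ₗ[A] QuotSMulTop x P :=
    (QuotSMulTop.map x (LinearMap.ker g).subtype).extendScalarsOfSurjective hsurj
  let g' : QuotSMulTop x P →ₗ[A] QuotSMulTop x M :=
    (QuotSMulTop.map x g).extendScalarsOfSurjective hsurj
  have hg' : Function.Surjective g' := QuotSMulTop.map_surjective x hg
  have hex : Function.Exact f' g' := QuotSMulTop.map_exact x g.exact_subtype_ker_map hg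
  have hf' : Function.Injective f' := by
    rw [injective_iff_map_eq_zero]
    intro k hk
    obtain ⟨k, rfl⟩ := Submodule.Quotient.mk_surjective _ k
    obtain ⟨p, -, hp⟩ := (Submodule.mem_smul_pointwise_iff_exists _ _ _).1
      ((Submodule.Quotient.mk_eq_zero _).1 hk)
    have hgp : g p = 0 := hx.right_eq_zero_of_smul (by
      rw [← map_smul, hp]
      exact k.2)
    refine (Submodule.Quotient.mk_eq_zero _).2
      ((Submodule.mem_smul_pointwise_iff_exists _ _ _).2 ⟨⟨p, hgp⟩, trivial, Subtype.ext hp⟩)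
  exact hasProjectiveDimensionLE_iff_of_exact f' g' hf' hex hg' m

/-- Reduction modulo a regular element does not increase the projective dimension. -/
theorem ModuleCat.hasProjectiveDimensionLE_quotSMulTop {x : R} (hx : x ∈ nonZeroDivisors R)
    (m : ℕ) (M : Type u) [AddCommGroup M] [Module R M] (hxM : IsSMulRegular M x)
    (h : HasProjectiveDimensionLE (ModuleCat.of R M) m) :
    HasProjectiveDimensionLE (ModuleCat.of (R ⧸ Ideal.span {x}) (QuotSMulTop x M)) m := by
  induction m generalizing M with
  | zero =>
    rw [hasProjectiveDimensionLE_zero_iff] at h ⊢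
    infer_instance
  | succ m ih =>
    have hg : Function.Surjective (Finsupp.linearCombination R (id : M → M)) :=
      Finsupp.linearCombination_id_surjective R M
    rw [hasProjectiveDimensionLE_quotSMulTop_ker_iff _ hg x hxM]
    exact ih _ (.submodule _ x (Module.Flat.isSMulRegular_of_nonZeroDivisors hx))
      ((hasProjectiveDimensionLE_ker_iff _ hg m).1 h)

variable [IsLocalRing R] [IsNoetherianRing R]

/-- Over a Noetherian local ring the projective dimension of a finite module can be computed after
reduction modulo a regular element. -/
theorem ModuleCat.hasProjectiveDimensionLE_of_quotSMulTop {x : R} (hx : x ∈ nonZeroDivisors R)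
    (hxm : x ∈ maximalIdeal R) (m : ℕ) (M : Type u) [AddCommGroup M] [Module R M]
    [Module.Finite R M] (hxM : IsSMulRegular M x)
    (h : HasProjectiveDimensionLE (ModuleCat.of (R ⧸ Ideal.span {x}) (QuotSMulTop x M)) m) :
    HasProjectiveDimensionLE (ModuleCat.of R M) m := by
  have hne : Ideal.span {x} ≠ ⊤ := fun h =>
    (maximalIdeal.isMaximal R).ne_top (top_le_iff.1 (h ▸ (Ideal.span_singleton_le_iff_mem _).2 hxm))
  have : Nontrivial (R ⧸ Ideal.span {x}) := Ideal.Quotient.nontrivial_iff.2 hne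
  have : IsLocalRing (R ⧸ Ideal.span {x}) :=
    .of_surjective' (Ideal.Quotient.mk _) Ideal.Quotient.mk_surjective
  induction m generalizing M with
  | zero =>
    rw [hasProjectiveDimensionLE_zero_iff] at h ⊢
    have : Module.Finite (R ⧸ Ideal.span {x}) (QuotSMulTop x M) :=
      Module.Finite.of_restrictScalars_finite R _ _
    have : Module.FinitePresentation R M := Module.finitePresentation_of_finite R M
    have : Module.Free (R ⧸ Ideal.span {x}) (QuotSMulTop x M) :=
      Module.free_of_flat_of_isLocalRing
    have : Module.Free R M := (Module.free_quotSMulTop_iff_free R M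
      ((jacobson_eq_maximalIdeal _ bot_ne_top).ge hxm) hxM).1 this
    infer_instance
  | succ m ih =>
    obtain ⟨k, g, hg⟩ := Module.Finite.exists_fin' R M
    rw [hasProjectiveDimensionLE_quotSMulTop_ker_iff g hg x hxM] at h
    rw [hasProjectiveDimensionLE_ker_iff g hg]
    exact ih _ (.submodule _ x (Module.Flat.isSMulRegular_of_nonZeroDivisors hx)) h

end ProjectiveDimension

/-- Finite modules over a regular local ring of Krull dimension `n` have projective dimension at
most `n`. For `n > 0` the first syzygy of the module is torsion-free, hence can be reduced modulo an
element of `𝔪 ∖ 𝔪²`. -/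
theorem IsRegularLocalRing.hasProjectiveDimensionLE (n : ℕ) :
    ∀ (R : Type u) [CommRing R] [IsRegularLocalRing R] (_ : ringKrullDim R = n)
      (M : Type u) [AddCommGroup M] [Module R M] [Module.Finite R M],
      HasProjectiveDimensionLE (ModuleCat.of R M) n := by
  induction n with
  | zero =>
    intro R _ _ h M _ _ _
    let := (isField_iff_maximalIdeal_eq.2 (maximalIdeal_eq_bot_iff.2 h)).toField
    rw [ModuleCat.hasProjectiveDimensionLE_zero_iff]
    have : Module.Free R M := Module.Free.of_divisionRing R M
    infer_instance
  | succ n ih =>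
    intro R _ _ hdim M _ _ _
    have hbot : maximalIdeal R ≠ ⊥ := by
      rw [Ne, maximalIdeal_eq_bot_iff, hdim]
      exact_mod_cast Nat.succ_ne_zero n
    obtain ⟨x, hx, hx2⟩ := SetLike.not_le_iff_exists.1 (not_maximalIdeal_le_sq hbot)
    obtain ⟨_, hd⟩ := quotient_span_singleton hx hx2
    have hd' : ringKrullDim (R ⧸ Ideal.span {x}) = n := by
      rw [hdim, Nat.cast_succ] at hd
      exact le_antisymm (ENat.WithBot.add_le_add_one_right_iff.1 hd.le)
        (ENat.WithBot.add_le_add_one_right_iff.1 hd.ge)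
    have hx0 : x ∈ nonZeroDivisors R :=
      mem_nonZeroDivisors_of_ne_zero fun h => hx2 (h ▸ zero_mem _)
    obtain ⟨k, g, hg⟩ := Module.Finite.exists_fin' R M
    rw [ModuleCat.hasProjectiveDimensionLE_ker_iff g hg]
    have : Module.Finite (R ⧸ Ideal.span {x}) (QuotSMulTop x (LinearMap.ker g)) :=
      Module.Finite.of_restrictScalars_finite R _ _
    exact ModuleCat.hasProjectiveDimensionLE_of_quotSMulTop hx0 hx n _
      (.submodule _ x (Module.Flat.isSMulRegular_of_nonZeroDivisors hx0)) (ih _ hd' _)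

/-- Finite modules over a regular ring of Krull dimension `n` have projective dimension at most
`n`. -/
theorem IsRegularRing.hasProjectiveDimensionLE {R : Type u} [CommRing R] [IsRegularRing R] {n : ℕ}
    (hn : ringKrullDim R ≤ n) (M : Type u) [AddCommGroup M] [Module R M] [Module.Finite R M] :
    HasProjectiveDimensionLE (ModuleCat.of R M) n := by
  rw [ModuleCat.hasProjectiveDimensionLE_iff_forall_maximalSpectrum]
  intro p
  have hdim : ringKrullDim (Localization.AtPrime p.1) ≤ n := by
    refine le_trans ?_ hn
    rw [IsLocalization.AtPrime.ringKrullDim_eq_height p.1]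
    exact Ideal.height_le_ringKrullDim_of_isPrime
  have hreg := (isRegularLocalRing_iff (Localization.AtPrime p.1)).1 inferInstance
  rw [← hreg] at hdim
  have : Module.Finite (Localization.AtPrime p.1)
      ((ModuleCat.of R M).localizedModule p.1.primeCompl) :=
    have := ModuleCat.localizedModule_isLocalizedModule (ModuleCat.of R M) p.1.primeCompl
    Module.Finite.of_isLocalizedModule p.1.primeCompl
      ((ModuleCat.of R M).localizedModuleMkLinearMap p.1.primeCompl)
  have := IsRegularLocalRing.hasProjectiveDimensionLE _ (Localization.AtPrime p.1) hreg.symm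
    ((ModuleCat.of R M).localizedModule p.1.primeCompl)
  exact hasProjectiveDimensionLT_of_ge _ _ _ (Nat.succ_le_succ (by exact_mod_cast hdim))

end RegularRings

/-! ### Extension of linear maps over hypersurfaces -/

/-- Let `M` be a module over `R ⧸ (w)`, with `w` a non-zero-divisor, whose projective dimension over
`R` is at most one. Then `Ext¹(M, P) = 0` over `R ⧸ (w)` for each projective `P`, in the form:
linear maps to `P` extend along submodules with quotient `M`. For `M = F / K` with `F`, `K`
projective over `R`, a map `K → P` lifts to a map `K → F'` with `F'` free over `R`, which extends to
`F` because `w F ⊆ K` and `w` is regular on `F'`. -/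
theorem exists_linearMap_extension {R : Type u} [CommRing R] {w : R} (hw : w ∈ nonZeroDivisors R)
    {X M P : Type u} [AddCommGroup X] [AddCommGroup M] [AddCommGroup P]
    [Module R X] [Module R M] [Module R P]
    [Module (R ⧸ Ideal.span {w}) X] [Module (R ⧸ Ideal.span {w}) M] [Module (R ⧸ Ideal.span {w}) P]
    [IsScalarTower R (R ⧸ Ideal.span {w}) X] [IsScalarTower R (R ⧸ Ideal.span {w}) M]
    [IsScalarTower R (R ⧸ Ideal.span {w}) P]
    [Module.Projective (R ⧸ Ideal.span {w}) P]
    (hM : HasProjectiveDimensionLE (ModuleCat.of R M) 1)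
    (π : X →ₗ[R ⧸ Ideal.span {w}] M) (hπ : Function.Surjective π)
    (g : LinearMap.ker π →ₗ[R ⧸ Ideal.span {w}] P) :
    ∃ g' : X →ₗ[R ⧸ Ideal.span {w}] P, ∀ z : LinearMap.ker π, g' z = g z := by
  classical
  let A := R ⧸ Ideal.span {w}
  have hw0 : algebraMap R A w = 0 :=
    Ideal.Quotient.eq_zero_iff_mem.2 (Ideal.mem_span_singleton_self w)
  -- `F` is free on `X`, and `K` is the kernel of `p : F → M`.
  let q : (X →₀ R) →ₗ[R] X := Finsupp.linearCombination R id
  have hq : Function.Surjective q := Finsupp.linearCombination_id_surjective R X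
  let p : (X →₀ R) →ₗ[R] M := π.restrictScalars R ∘ₗ q
  have hp : Function.Surjective p := hπ.comp hq
  have hproj : Module.Projective R (LinearMap.ker p) :=
    (ModuleCat.hasProjectiveDimensionLE_zero_iff _).1
      ((ModuleCat.hasProjectiveDimensionLE_ker_iff p hp 0).1 hM)
  let gK : LinearMap.ker p →ₗ[R] P :=
    g.restrictScalars R ∘ₗ
      (q ∘ₗ (LinearMap.ker p).subtype).codRestrict ((LinearMap.ker π).restrictScalars R)
        fun x => x.2
  -- `gK : K → P` lifts to `l : K → F'`, where `F'` is free on `P` and `s` splits `F' / w F' → P`.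
  obtain ⟨s, hs⟩ := (Module.projective_def' (R := A) (P := P)).1 ‹_›
  let r : (P →₀ R) →ₗ[R] (P →₀ A) := Finsupp.mapRange.linearMap (Algebra.linearMap R A)
  have hr : Function.Surjective r :=
    Finsupp.mapRange_surjective _ (map_zero _) Ideal.Quotient.mk_surjective
  obtain ⟨l, hl⟩ := Module.projective_lifting_property r (s.restrictScalars R ∘ₗ gK) hr
  have hl' : ∀ x, r (l x) = s (gK x) := fun x => LinearMap.congr_fun hl x
  have hinj : Function.Injective (LinearMap.lsmul R (P →₀ R) w) :=
    Module.Flat.isSMulRegular_of_nonZeroDivisors hw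
  have hwx : ∀ x : X →₀ R, q (w • x) = 0 := fun x => by
    rw [map_smul, ← algebraMap_smul A, hw0, zero_smul]
  have hwK : ∀ x : X →₀ R, w • x ∈ LinearMap.ker p := fun x => by
    change π (q (w • x)) = 0
    rw [hwx, map_zero]
  have hgK : ∀ x : LinearMap.ker p, q x = 0 → gK x = 0 := fun x hx => by
    change g ⟨q x, _⟩ = 0
    rw [← map_zero g]
    exact congrArg g (Subtype.ext hx)
  -- `l (w x)` is divisible by `w` because `gK (w x) = 0`; its quotient `μ x` by `w`
  -- extends `l` to `F`.
  have hrange : ∀ x : X →₀ R,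
      l ⟨w • x, hwK x⟩ ∈ LinearMap.range (LinearMap.lsmul R (P →₀ R) w) := by
    intro x
    have h0 : r (l ⟨w • x, hwK x⟩) = 0 := by rw [hl', hgK _ (hwx x), map_zero]
    have h1 : ∀ i, ∃ c, l ⟨w • x, hwK x⟩ i = w * c := fun i => by
      have := DFunLike.congr_fun h0 i
      exact Ideal.mem_span_singleton.1 (Ideal.Quotient.eq_zero_iff_mem.1 this)
    choose c hc using h1
    refine ⟨Finsupp.onFinset (l ⟨w • x, hwK x⟩).support
      (fun i => if l ⟨w • x, hwK x⟩ i = 0 then 0 else c i)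
      fun i hi => ?_, ?_⟩
    · rw [Finsupp.mem_support_iff]
      exact fun h => hi (if_pos h)
    · ext i
      change w * (if l ⟨w • x, hwK x⟩ i = 0 then 0 else c i) = _
      split_ifs with h
      · rw [mul_zero, h]
      · exact (hc i).symm
  let wK : (X →₀ R) →ₗ[R] LinearMap.ker p := (LinearMap.lsmul R (X →₀ R) w).codRestrict _ hwK
  let μ : (X →₀ R) →ₗ[R] (P →₀ R) :=
    (LinearEquiv.ofInjective _ hinj).symm.toLinearMap ∘ₗ (l ∘ₗ wK).codRestrict _ hrange
  have hμ : ∀ x, w • μ x = l ⟨w • x, hwK x⟩ := fun x =>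
    congrArg Subtype.val ((LinearEquiv.ofInjective _ hinj).apply_symm_apply
      ((l ∘ₗ wK).codRestrict _ hrange x))
  have hμK : ∀ x : LinearMap.ker p, μ x = l x := fun x => hinj (by
    change w • μ x = w • l x
    rw [hμ, ← map_smul]
    rfl)
  let h : (X →₀ R) →ₗ[R] P := (Finsupp.linearCombination A id).restrictScalars R ∘ₗ r ∘ₗ μ
  have hK : ∀ x : LinearMap.ker p, h x = gK x := fun x => by
    change Finsupp.linearCombination A id (r (μ x)) = _
    rw [hμK, hl']
    exact LinearMap.congr_fun hs _
  -- The extension `h` of `gK` vanishes on the kernel of `F → X`, so it descends to `X`.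
  have hker : LinearMap.ker q ≤ LinearMap.ker h := fun x hx => by
    have hx' : q x = 0 := hx
    have hxp : x ∈ LinearMap.ker p := by
      change π (q x) = 0
      rw [hx', map_zero]
    exact (hK ⟨x, hxp⟩).trans (hgK ⟨x, hxp⟩ hx')
  let g₀ : X →ₗ[R] P := (LinearMap.ker q).liftQ h hker ∘ₗ (q.quotKerEquivOfSurjective hq).symm
  have hg₀ : ∀ x, g₀ (q x) = h x := fun x => by
    have : (q.quotKerEquivOfSurjective hq).symm (q x) = Submodule.Quotient.mk x :=
      (LinearEquiv.symm_apply_eq _).2 rfl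
    change (LinearMap.ker q).liftQ h hker ((q.quotKerEquivOfSurjective hq).symm (q x)) = _
    rw [this]
    rfl
  refine ⟨g₀.extendScalarsOfSurjective (S := A) Ideal.Quotient.mk_surjective, fun z => ?_⟩
  obtain ⟨x, hx⟩ := hq z
  have hxp : x ∈ LinearMap.ker p := by
    change π (q x) = 0
    rw [hx]
    exact z.2
  change g₀ z = _
  rw [← hx, hg₀, hK ⟨x, hxp⟩]
  exact congrArg g (Subtype.ext hx)

/-! ### Graded free covers and degree zero components -/

namespace GrMod

variable {L : Type v} [AddCommGroup L] [DecidableEq L] {A : Type u} [CommRing A]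
  {𝒜 : L → AddSubgroup A}

theorem comp_smul (N : GrMod 𝒜) {i : L} {a : A} (ha : a ∈ 𝒜 i) (j : L) (y : N) :
    SubgroupGrading.comp N.isInternal (i + j) (a • y) =
      a • SubgroupGrading.comp N.isInternal j y := by
  have hy : y ∈ ⨆ k, N.gr k := SubgroupGrading.iSup_eq_top N.isInternal ▸ AddSubgroup.mem_top y
  induction hy using AddSubgroup.iSup_induction' with
  | hp k y hy =>
    by_cases hjk : j = k
    · subst hjk
      rw [SubgroupGrading.comp_self _ _ _ hy, SubgroupGrading.comp_self _ _ _ (N.smul_mem ha hy)]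
    · rw [SubgroupGrading.comp_ne _ _ _ hjk _ hy, smul_zero,
        SubgroupGrading.comp_ne _ _ (i + k) (by simpa using hjk) _ (N.smul_mem ha hy)]
  | h1 => simp
  | hadd x y _ _ hx hy => simp only [smul_add, map_add, hx, hy]

/-- A linear map has a degree zero component, which is a graded morphism. -/
theorem exists_hom_of_linearMap (h𝒜 : ⨆ i, 𝒜 i = ⊤) {M N : GrMod 𝒜} (g : M →ₗ[A] N) :
    ∃ g₀ : M ⟶ N, ∀ i, ∀ x ∈ M.gr i,
      g₀.toLin x = SubgroupGrading.comp N.isInternal i (g x) := by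
  let φ : M →+ N := (DirectSum.toAddMonoid fun i => (SubgroupGrading.comp N.isInternal i).comp
    (g.toAddMonoidHom.comp (M.gr i).subtype)).comp
      (AddEquiv.ofBijective (DirectSum.coeAddMonoidHom M.gr) M.isInternal).symm.toAddMonoidHom
  have hφ : ∀ i, ∀ x ∈ M.gr i, φ x = SubgroupGrading.comp N.isInternal i (g x) := fun i x hx => by
    have : (AddEquiv.ofBijective (DirectSum.coeAddMonoidHom M.gr) M.isInternal).symm x =
        DirectSum.of (fun i => M.gr i) i ⟨x, hx⟩ :=
      (AddEquiv.symm_apply_eq _).2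
        (DirectSum.coeAddMonoidHom_of M.gr i ⟨x, hx⟩).symm
    change DirectSum.toAddMonoid _
      ((AddEquiv.ofBijective (DirectSum.coeAddMonoidHom M.gr) M.isInternal).symm x) = _
    rw [this, DirectSum.toAddMonoid_of]
    rfl
  have hsmul : ∀ (a : A) (x : M), φ (a • x) = a • φ x := fun a x => by
    have ha : a ∈ ⨆ i, 𝒜 i := h𝒜 ▸ AddSubgroup.mem_top a
    induction ha using AddSubgroup.iSup_induction' with
    | hp i a ha =>
      have hx : x ∈ ⨆ j, M.gr j :=
        SubgroupGrading.iSup_eq_top M.isInternal ▸ AddSubgroup.mem_top x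
      induction hx using AddSubgroup.iSup_induction' with
      | hp j x hx => rw [hφ _ _ (M.smul_mem ha hx), hφ _ _ hx, map_smul, comp_smul N ha]
      | h1 => simp
      | hadd x y _ _ hx hy => simp only [smul_add, map_add, hx, hy]
    | h1 => simp
    | hadd a b _ _ ha hb => simp only [add_smul, map_add, ha, hb]
  refine ⟨⟨{ φ with map_smul' := hsmul }, fun {i x} hx => ?_⟩, hφ⟩
  change φ x ∈ _
  rw [hφ i x hx]
  exact SubgroupGrading.comp_mem _ _ _

theorem hom_ext_of_homogeneous {M N : GrMod 𝒜} {f g : M ⟶ N}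
    (h : ∀ i, ∀ x ∈ M.gr i, f.toLin x = g.toLin x) : f = g := by
  ext x
  have hx : x ∈ ⨆ i, M.gr i := SubgroupGrading.iSup_eq_top M.isInternal ▸ AddSubgroup.mem_top x
  induction hx using AddSubgroup.iSup_induction' with
  | hp i x hx => exact h i x hx
  | h1 => simp
  | hadd x y _ _ hx hy => simp only [map_add, hx, hy]

theorem epi_of_surjective {M N : GrMod 𝒜} (f : M ⟶ N) (hf : Function.Surjective f.toLin) :
    Epi f where
  left_cancellation g h e := by
    ext x
    obtain ⟨x, rfl⟩ := hf x
    rw [← comp_apply, e, comp_apply]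

theorem mono_of_injective {M N : GrMod 𝒜} (f : M ⟶ N) (hf : Function.Injective f.toLin) :
    Mono f where
  right_cancellation g h e := by
    ext x
    apply hf
    rw [← comp_apply, e, comp_apply]

/-- A lift given by projectivity of the underlying module need not preserve degrees, but its degree
zero component is again a lift. -/
theorem projective_of_module_projective (h𝒜 : ⨆ i, 𝒜 i = ⊤) (P : GrMod 𝒜) [Module.Projective A P] :
    Projective P where
  factors {E X} f e _ := by
    obtain ⟨g, hg⟩ := Module.projective_lifting_property e.toLin f.toLin (surjective_of_epi e)
    obtain ⟨g₀, hg₀⟩ := exists_hom_of_linearMap h𝒜 g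
    refine ⟨g₀, hom_ext_of_homogeneous fun i x hx => ?_⟩
    rw [comp_apply, hg₀ i x hx, toLin_comp, ← LinearMap.comp_apply, hg]
    exact SubgroupGrading.comp_self _ _ _ (f.map_mem hx)

theorem exists_homogeneous_generators (M : GrMod 𝒜) :
    ∃ (n : ℕ) (deg : Fin n → L) (y : Fin n → M), (∀ k, y k ∈ M.gr (deg k)) ∧
      Submodule.span A (Set.range y) = ⊤ := by
  obtain ⟨S, hS⟩ := M.finite.fg_top
  choose s hs using fun x : M => SubgroupGrading.sum_comp M.isInternal x
  let ι := Σ x : S, s x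
  let e := Fintype.equivFin ι
  let z : ι → M := fun p => SubgroupGrading.comp M.isInternal p.2 p.1
  refine ⟨Fintype.card ι, fun k => (e.symm k).2, fun k => z (e.symm k),
    fun k => SubgroupGrading.comp_mem _ _ _, ?_⟩
  have hrange : (Set.range fun k => z (e.symm k)) = Set.range z := e.symm.surjective.range_comp z
  rw [hrange, eq_top_iff, ← hS, Submodule.span_le]
  intro x hx
  rw [hs x]
  exact sum_mem fun i hi => Submodule.subset_span ⟨⟨⟨x, hx⟩, ⟨i, hi⟩⟩, rfl⟩

/-- The graded free module with a basis of homogeneous elements of prescribed degrees. -/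
def free (𝒜 : L → AddSubgroup A) [GradedRing 𝒜] {n : ℕ} (deg : Fin n → L) : GrMod 𝒜 where
  carrier := Fin n → A
  gr l := AddSubgroup.pi Set.univ fun k => 𝒜 (l - deg k)
  isInternal := by
    have h : DirectSum.IsInternal 𝒜 := DirectSum.Decomposition.isInternal 𝒜
    refine SubgroupGrading.isInternal_of_components _
      (fun l => AddMonoidHom.pi fun k =>
        (SubgroupGrading.comp h (l - deg k)).comp (Pi.evalAddMonoidHom (fun _ => A) k)) ?_ ?_ ?_
    · intro l x hx
      ext k
      exact SubgroupGrading.comp_self h _ _ (hx k trivial)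
    · intro i j hij x hx
      ext k
      exact SubgroupGrading.comp_ne h _ (j - deg k) (by simpa using hij) _ (hx k trivial)
    · rw [eq_top_iff]
      intro x _
      rw [← Finset.univ_sum_single x]
      refine sum_mem fun k _ => ?_
      obtain ⟨s, hs⟩ := SubgroupGrading.sum_comp h (x k)
      rw [hs, ← AddMonoidHom.single_apply (f := fun _ : Fin n => A), map_sum]
      refine sum_mem fun i _ => AddSubgroup.mem_iSup_of_mem (i + deg k) fun k' _ => ?_
      rw [AddMonoidHom.single_apply]
      change _ ∈ 𝒜 (i + deg k - deg k')
      by_cases hk : k' = k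
      · subst hk
        rw [Pi.single_eq_same, add_sub_cancel_right]
        exact SubgroupGrading.comp_mem h i _
      · rw [Pi.single_eq_of_ne hk]
        exact zero_mem _
  smul_mem {i j a m} ha hm k _ := by
    change a * m k ∈ 𝒜 (i + j - deg k)
    rw [add_sub_assoc]
    exact SetLike.GradedMul.mul_mem ha (hm k trivial)
  finite := inferInstance

instance (𝒜 : L → AddSubgroup A) [GradedRing 𝒜] {n : ℕ} (deg : Fin n → L) :
    Module.Free A (free 𝒜 deg) :=
  inferInstanceAs (Module.Free A (Fin n → A))

theorem exists_free_cover [GradedRing 𝒜] (M : GrMod 𝒜) :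
    ∃ (F : GrMod 𝒜) (π : F ⟶ M), Module.Free A F ∧ Function.Surjective π.toLin := by
  obtain ⟨n, deg, y, hy, hspan⟩ := exists_homogeneous_generators M
  refine ⟨free 𝒜 deg, ⟨Fintype.linearCombination A y, fun {i x} hx => ?_⟩, inferInstance, ?_⟩
  · change ∑ k, x k • y k ∈ M.gr i
    refine sum_mem fun k _ => ?_
    have := M.smul_mem (hx k trivial) (hy k)
    rwa [sub_add_cancel] at this
  · rw [← LinearMap.range_eq_top]
    exact (Fintype.range_linearCombination A y).trans hspan

theorem iSup_grading_eq_top (𝒜 : L → AddSubgroup A) [GradedRing 𝒜] : ⨆ i, 𝒜 i = ⊤ :=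
  SubgroupGrading.iSup_eq_top (DirectSum.Decomposition.isInternal 𝒜)

/-- The short exact sequence of a surjection and its kernel. -/
theorem kerι_shortExact [IsNoetherianRing A] {M N : GrMod 𝒜} (f : M ⟶ N)
    (hf : Function.Surjective f.toLin) :
    (ShortComplex.mk (kerι f) f (kerι_comp f)).ShortExact where
  exact := ShortComplex.exact_of_f_is_kernel _ (isLimitOfInjective (kerι f) f
    Subtype.val_injective (kerι_comp f) fun x hx => ⟨⟨x, hx⟩, rfl⟩)
  mono_f := mono_of_injective _ Subtype.val_injective
  epi_g := epi_of_surjective _ hf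

end GrMod

/-! ### The four-term exact sequence over a hypersurface -/

namespace GrMod

variable {L : Type v} [AddCommGroup L] [DecidableEq L]

theorem shortExact_of_exact {A : Type u} [CommRing A] {𝒜 : L → AddSubgroup A} [IsNoetherianRing A]
    {X Y Z : GrMod 𝒜} (f : X ⟶ Y) (g : Y ⟶ Z) (hf : Function.Injective f.toLin)
    (hfg : Function.Exact f.toLin g.toLin) (hg : Function.Surjective g.toLin) :
    (ShortComplex.mk f g (by ext x; exact hfg.apply_apply_eq_zero x)).ShortExact where
  exact := ShortComplex.exact_of_f_is_kernel _
    (isLimitOfInjective f g hf _ fun x hx => (hfg x).1 hx)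
  mono_f := mono_of_injective _ hf
  epi_g := epi_of_surjective _ hg

variable {R : Type u} [CommRing R] {𝓡 : L → AddSubgroup R}

section Restrict

variable {I : Ideal R}

/-- The scalar action of `R` through its quotient. -/
instance (N : GrMod (quotientGrading 𝓡 I)) : Module R N :=
  Module.compHom N (Ideal.Quotient.mk I)

instance (N : GrMod (quotientGrading 𝓡 I)) : IsScalarTower R (R ⧸ I) N where
  smul_assoc r a x := mul_smul (Ideal.Quotient.mk I r) a x

instance (N : GrMod (quotientGrading 𝓡 I)) : Module.Finite R N :=
  Module.Finite.trans (R ⧸ I) N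

/-- A graded module over a quotient of `R`, regarded as a graded module over `R`. -/
def restrict (N : GrMod (quotientGrading 𝓡 I)) : GrMod 𝓡 where
  carrier := N
  gr := N.gr
  isInternal := N.isInternal
  smul_mem ha hm := N.smul_mem ⟨_, ha, rfl⟩ hm
  finite := inferInstance

end Restrict

variable {w : R} {d : L}

theorem comp_smul_of_mem (hwd : w ∈ 𝓡 d) (K : GrMod 𝓡) (i : L) (x : K) :
    SubgroupGrading.comp K.isInternal i (w • x) =
      w • SubgroupGrading.comp K.isInternal (i - d) x := by
  rw [← comp_smul K hwd, add_sub_cancel]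

open scoped Pointwise in
theorem quotSMulTop_mk_eq_zero_iff {M : Type*} [AddCommGroup M] [Module R M] (x : M) :
    (Submodule.Quotient.mk x : QuotSMulTop w M) = 0 ↔ ∃ y, w • y = x :=
  (Submodule.Quotient.mk_eq_zero _).trans
    ((Submodule.mem_smul_pointwise_iff_exists _ _ _).trans
      ⟨fun ⟨y, _, h⟩ => ⟨y, h⟩, fun ⟨y, h⟩ => ⟨y, trivial, h⟩⟩)

/-- The reduction `K / w K` of a graded `R`-module `K` modulo a homogeneous element `w`. -/
def reduce (hwd : w ∈ 𝓡 d) (K : GrMod 𝓡) : GrMod (quotientGrading 𝓡 (Ideal.span {w})) where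
  carrier := QuotSMulTop w K
  gr i := (K.gr i).map (Submodule.mkQ _).toAddMonoidHom
  isInternal := SubgroupGrading.isInternal_map K.isInternal _
    (Submodule.mkQ_surjective _) fun i x hx => by
      obtain ⟨y, rfl⟩ := (quotSMulTop_mk_eq_zero_iff x).1 hx
      exact (quotSMulTop_mk_eq_zero_iff _).2 ⟨_, (comp_smul_of_mem hwd K i y).symm⟩
  smul_mem := by
    rintro i j _ _ ⟨r, hr, rfl⟩ ⟨x, hx, rfl⟩
    exact ⟨r • x, K.smul_mem hr hx, rfl⟩
  finite := Module.Finite.of_restrictScalars_finite R _ _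

/-- The map `K / w K → K' / w K'` induced by `K → K'`. -/
def reduceMap (hwd : w ∈ 𝓡 d) {K K' : GrMod 𝓡} (f : K ⟶ K') : reduce hwd K ⟶ reduce hwd K' where
  toLin := LinearMap.extendScalarsOfSurjective (S := R ⧸ Ideal.span {w}) (M := QuotSMulTop w K)
    (N := QuotSMulTop w K') Ideal.Quotient.mk_surjective (QuotSMulTop.map w f.toLin)
  map_mem := by
    rintro i _ ⟨x, hx, rfl⟩
    exact ⟨f.toLin x, f.map_mem hx, rfl⟩

theorem restrict_smul_eq_zero {N : GrMod (quotientGrading 𝓡 (Ideal.span {w}))}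
    (x : restrict N) : w • x = 0 := by
  change Ideal.Quotient.mk (Ideal.span {w}) w • (show N from x) = 0
  rw [Ideal.Quotient.eq_zero_iff_mem.2 (Ideal.mem_span_singleton_self w), zero_smul]

/-- The map `K / w K → N` induced by a map from `K` to a module annihilated by `w`. -/
def reduceDesc (hwd : w ∈ 𝓡 d) {K : GrMod 𝓡} {N : GrMod (quotientGrading 𝓡 (Ideal.span {w}))}
    (f : K ⟶ restrict N) : reduce hwd K ⟶ N where
  toLin :=
    let φ : QuotSMulTop w K →ₗ[R] restrict N := Submodule.liftQ _ f.toLin fun x hx => by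
      obtain ⟨y, rfl⟩ := (quotSMulTop_mk_eq_zero_iff x).1 ((Submodule.Quotient.mk_eq_zero _).2 hx)
      rw [LinearMap.mem_ker, map_smul, restrict_smul_eq_zero]
    { toFun := φ
      map_add' := φ.map_add
      map_smul' := fun a x => by
        obtain ⟨r, rfl⟩ := Ideal.Quotient.mk_surjective a
        exact φ.map_smul r x }
  map_mem := by
    rintro i _ ⟨x, hx, rfl⟩
    exact f.map_mem hx

/-- A graded module `N` over `R ⧸ (w)`, presented over `R` as `F / K` with `F` free, sits in an
exact sequence `0 → N(-d) → K / w K → F / w F → N → 0`; the module `N(-d)` appears as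
`w F / w K`. -/
theorem exists_periodicity_sequences [IsNoetherianRing R] [GradedRing 𝓡] (hwd : w ∈ 𝓡 d)
    (hw : w ∈ nonZeroDivisors R) (n : ℕ)
    (hn : ∀ (M : Type u) [AddCommGroup M] [Module R M] [Module.Finite R M],
      HasProjectiveDimensionLE (ModuleCat.of R M) n)
    (N : GrMod (quotientGrading 𝓡 (Ideal.span {w}))) :
    ∃ S T : ShortComplex (GrMod (quotientGrading 𝓡 (Ideal.span {w}))),
      S.ShortExact ∧ T.ShortExact ∧ S.X₁ = N.shift (-d) ∧ S.X₃ = T.X₁ ∧ T.X₃ = N ∧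
      HasProjectiveDimensionLE (ModuleCat.of (R ⧸ Ideal.span {w}) S.X₂) n ∧
      Module.Projective (R ⧸ Ideal.span {w}) T.X₂ := by
  obtain ⟨F, π, hF, hπ⟩ := exists_free_cover (restrict N)
  have hreg : IsSMulRegular F w := Module.Flat.isSMulRegular_of_nonZeroDivisors hw
  let K := ker π
  -- `β : F / w F → N`, `α : K / w K → F / w F` with image `ker β`, and `ρ` its corestriction.
  let β : reduce hwd F ⟶ N := reduceDesc hwd π
  have hβ : Function.Surjective β.toLin := fun x => by
    obtain ⟨y, rfl⟩ := hπ x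
    exact ⟨Submodule.Quotient.mk y, rfl⟩
  let α : reduce hwd K ⟶ reduce hwd F := reduceMap hwd (kerι π)
  have hαβ : ∀ x, β.toLin x = 0 ↔ ∃ y, α.toLin y = x := fun x => by
    constructor
    · intro hx
      obtain ⟨x, rfl⟩ := Submodule.Quotient.mk_surjective _ x
      exact ⟨Submodule.Quotient.mk ⟨x, hx⟩, rfl⟩
    · rintro ⟨y, rfl⟩
      obtain ⟨y, rfl⟩ := Submodule.Quotient.mk_surjective _ y
      exact y.2
  let ρ : reduce hwd K ⟶ ker β :=
    liftInj (kerι β) Subtype.val_injective α fun x => ⟨⟨_, (hαβ _).2 ⟨x, rfl⟩⟩, rfl⟩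
  have hρ : ∀ x, (kerι β).toLin (ρ.toLin x) = α.toLin x := fun x =>
    congrArg (fun f => f.toLin x) (liftInj_comp (kerι β) Subtype.val_injective α _)
  -- Multiplication by `w` maps `F(-d)` to `K` and `K(-d)` to `w K`, so it induces a map
  -- `γ : N(-d) → K / w K`; here `β'` is the projection of `F(-d) / w F(-d)` to `N(-d)`.
  let m : F.shift (-d) ⟶ K :=
    { toLin := (LinearMap.lsmul R F w).codRestrict _ fun x => by
        rw [LinearMap.mem_ker, LinearMap.lsmul_apply, map_smul, restrict_smul_eq_zero]
      map_mem := fun {i x} hx => by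
        have := F.smul_mem hwd hx
        rw [add_neg_cancel_left] at this
        exact this }
  let ψ : reduce hwd (F.shift (-d)) ⟶ reduce hwd K := reduceMap hwd m
  let π' : F.shift (-d) ⟶ restrict (N.shift (-d)) := ⟨π.toLin, fun h => π.map_mem h⟩
  let β' : reduce hwd (F.shift (-d)) ⟶ N.shift (-d) := reduceDesc hwd π'
  have hβ' : Function.Surjective β'.toLin := hβ
  have hβψ : ∀ x, β'.toLin x = 0 → ψ.toLin x = 0 := fun x hx => by
    obtain ⟨x, rfl⟩ := Submodule.Quotient.mk_surjective _ x
    exact (quotSMulTop_mk_eq_zero_iff _).2 ⟨⟨x, hx⟩, rfl⟩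
  let γ : N.shift (-d) ⟶ reduce hwd K := descSurj β' hβ' ψ hβψ
  have hγ : ∀ x, γ.toLin (β'.toLin x) = ψ.toLin x := fun x =>
    congrArg (fun f => f.toLin x) (comp_descSurj β' hβ' ψ hβψ)
  have hγinj : Function.Injective γ.toLin := by
    rw [injective_iff_map_eq_zero]
    intro x hx
    obtain ⟨x, rfl⟩ := hβ' x
    obtain ⟨x, rfl⟩ := Submodule.Quotient.mk_surjective _ x
    obtain ⟨y, hy⟩ := (quotSMulTop_mk_eq_zero_iff _).1 ((hγ _).symm.trans hx)
    have : (kerι π).toLin y = x := hreg (congrArg (kerι π).toLin hy)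
    change π.toLin x = 0
    rw [← this]
    exact apply_apply_of_comp (kerι_comp π) y
  have hex : Function.Exact γ.toLin ρ.toLin := fun x => by
    constructor
    · intro hx
      obtain ⟨k, rfl⟩ := Submodule.Quotient.mk_surjective _ x
      obtain ⟨y, hy⟩ := (quotSMulTop_mk_eq_zero_iff _).1
        ((hρ _).symm.trans (congrArg (kerι β).toLin hx))
      refine ⟨β'.toLin (Submodule.Quotient.mk y), (hγ _).trans ?_⟩
      exact congrArg Submodule.Quotient.mk (Subtype.ext hy)
    · rintro ⟨x, rfl⟩
      obtain ⟨x, rfl⟩ := hβ' x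
      obtain ⟨x, rfl⟩ := Submodule.Quotient.mk_surjective _ x
      apply Subtype.ext
      refine ((hρ _).trans (congrArg α.toLin (hγ _))).trans ?_
      exact (quotSMulTop_mk_eq_zero_iff _).2 ⟨x, rfl⟩
  have hρsurj : Function.Surjective ρ.toLin := fun x => by
    obtain ⟨y, hy⟩ := (hαβ x.1).1 x.2
    exact ⟨y, Subtype.ext ((hρ y).trans hy)⟩
  refine ⟨_, _, shortExact_of_exact γ ρ hγinj hex hρsurj, kerι_shortExact β hβ, rfl, rfl, rfl,
    ?_, ?_⟩
  · exact ModuleCat.hasProjectiveDimensionLE_quotSMulTop hw n K (.submodule _ w hreg) (hn K)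
  · exact inferInstanceAs (Module.Projective (R ⧸ Ideal.span {w}) (QuotSMulTop w F))

end GrMod

/-! ### Vanishing of extensions by projectives -/

namespace GrMod

variable {L : Type v} [AddCommGroup L] [DecidableEq L]

theorem module_projective_of_projective {A : Type u} [CommRing A] {𝒜 : L → AddSubgroup A}
    [GradedRing 𝒜] (P : GrMod 𝒜) [Projective P] : Module.Projective A P := by
  obtain ⟨F, π, _, hπ⟩ := exists_free_cover P
  have := epi_of_surjective π hπ
  refine Module.Projective.of_split (Projective.factorThru (𝟙 P) π).toLin π.toLin ?_
  exact LinearMap.ext fun x =>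
    congrArg (fun f => f.toLin x) (Projective.factorThru_comp (𝟙 P) π)

variable {R : Type u} [CommRing R] {𝓡 : L → AddSubgroup R} {w : R}

/-- A free module over `R ⧸ (w)` has projective dimension at most one over `R`. -/
theorem _root_.ModuleCat.hasProjectiveDimensionLE_one_of_free (hw : w ∈ nonZeroDivisors R)
    {F : Type u} [AddCommGroup F] [Module R F] [Module (R ⧸ Ideal.span {w}) F]
    [IsScalarTower R (R ⧸ Ideal.span {w}) F] [Module.Free (R ⧸ Ideal.span {w}) F]
    [Module.Finite (R ⧸ Ideal.span {w}) F] :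
    HasProjectiveDimensionLE (ModuleCat.of R F) 1 := by
  rcases subsingleton_or_nontrivial (R ⧸ Ideal.span {w}) with _ | _
  · have := Module.subsingleton (R ⧸ Ideal.span {w}) F
    have := (ModuleCat.isZero_of_subsingleton (ModuleCat.of R F)).hasProjectiveDimensionLT_zero
    exact hasProjectiveDimensionLT_of_ge _ 0 _ (by simp)
  let ι := Fin (Module.finrank (R ⧸ Ideal.span {w}) F)
  let b := Module.finBasis (R ⧸ Ideal.span {w}) F
  let g : (ι → R) →ₗ[R] F := (b.equivFun.symm.toLinearMap.restrictScalars R).comp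
    ((Ideal.Quotient.mkₐ R (Ideal.span {w})).toLinearMap.compLeft ι)
  refine (ModuleCat.hasProjectiveDimensionLE_iff_of_exact (LinearMap.lsmul R (ι → R) w) g
    (Module.Flat.isSMulRegular_of_nonZeroDivisors hw) (fun x => ?_)
    (b.equivFun.symm.surjective.comp (Ideal.Quotient.mk_surjective.comp_left)) 0).2
    ((ModuleCat.hasProjectiveDimensionLE_zero_iff _).2 inferInstance)
  refine (b.equivFun.symm.map_eq_zero_iff (x := fun k => Ideal.Quotient.mk _ (x k))).trans ?_
  simp only [funext_iff, Pi.zero_apply, Ideal.Quotient.eq_zero_iff_mem,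
    Ideal.mem_span_singleton', Set.mem_range, LinearMap.lsmul_apply, Pi.smul_apply, smul_eq_mul]
  refine ⟨fun h => ?_, fun ⟨y, hy⟩ k => ⟨y k, by rw [mul_comm, hy]⟩⟩
  choose y hy using h
  exact ⟨y, fun k => by rw [mul_comm, hy]⟩

open Abelian in
/-- The vanishing of `Ext` against projectives is governed by the projective dimension over `R`, not
over `R ⧸ (w)`. Dimension shifting along free covers over `R ⧸ (w)`, which have projective dimension
at most one over `R`, reduces this to `k = 0`, that is to the extension of morphisms to `P`. -/
theorem ext_eq_zero_of_hasProjectiveDimensionLE [IsNoetherianRing R]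
    [GradedRing (quotientGrading 𝓡 (Ideal.span {w}))]
    (hw : w ∈ nonZeroDivisors R)
    [HasExt.{max v (u + 1)} (GrMod (quotientGrading 𝓡 (Ideal.span {w})))]
    (P : GrMod (quotientGrading 𝓡 (Ideal.span {w}))) [Projective P] (k : ℕ)
    (M : GrMod (quotientGrading 𝓡 (Ideal.span {w})))
    (hM : HasProjectiveDimensionLE (ModuleCat.of R M) (k + 1)) (x : Ext M P (k + 1)) : x = 0 := by
  have := module_projective_of_projective P
  have h𝒜 := iSup_grading_eq_top (quotientGrading 𝓡 (Ideal.span {w}))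
  induction k generalizing M with
  | zero =>
    obtain ⟨F, π, _, hπ⟩ := exists_free_cover M
    have := projective_of_module_projective h𝒜 F
    obtain ⟨y, rfl⟩ := Ext.contravariant_sequence_exact₃ (kerι_shortExact π hπ) _ x
      (Ext.eq_zero_of_projective _) (n₀ := 0) rfl
    obtain ⟨g, rfl⟩ := Ext.homEquiv₀.symm.surjective y
    obtain ⟨g', hg'⟩ := exists_linearMap_extension hw hM π.toLin hπ g.toLin
    -- The extension `g'` need not preserve degrees; its degree zero component still extends `g`.
    obtain ⟨g₀, hg₀⟩ := exists_hom_of_linearMap h𝒜 g'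
    have : kerι π ≫ g₀ = g := hom_ext_of_homogeneous fun i z hz => by
      rw [comp_apply, hg₀ i _ ((kerι π).map_mem hz)]
      refine (congrArg _ (hg' z)).trans ?_
      exact SubgroupGrading.comp_self _ _ _ (g.map_mem hz)
    change (kerι_shortExact π hπ).extClass.comp (Ext.mk₀ g) _ = 0
    rw [← this, ← Ext.mk₀_comp_mk₀]
    exact (kerι_shortExact π hπ).extClass_comp_assoc (Ext.mk₀ g₀)
  | succ k ih =>
    obtain ⟨F, π, _, hπ⟩ := exists_free_cover M
    have := projective_of_module_projective h𝒜 F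
    obtain ⟨y, rfl⟩ := Ext.contravariant_sequence_exact₃ (kerι_shortExact π hπ) _ x
      (Ext.eq_zero_of_projective _) (n₀ := k + 1) (add_comm _ _)
    have hS := ModuleCat.shortComplex_shortExact
      (ModuleCat.shortComplexOfCompEqZero ((kerι π).toLin.restrictScalars R)
        (π.toLin.restrictScalars R) (LinearMap.ext fun x => x.2))
      (π.toLin.exact_subtype_ker_map) Subtype.val_injective hπ
    have hF : HasProjectiveDimensionLE (ModuleCat.of R F) 1 :=
      ModuleCat.hasProjectiveDimensionLE_one_of_free hw
    rw [ih (ker π) (hS.hasProjectiveDimensionLT_X₁ (k + 2)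
      (hasProjectiveDimensionLT_of_ge _ 2 _ (by lia)) hM) y, Ext.comp_zero]

open Abelian in
/-- `Ext` against projectives vanishes in degrees at least `n` when all finite modules over `R` have
projective dimension at most `n`. This includes degree zero if `n = 0`, since then the zero module
is the only module over `R ⧸ (w)`. -/
theorem ext_eq_zero_of_forall_hasProjectiveDimensionLE [IsNoetherianRing R]
    [GradedRing (quotientGrading 𝓡 (Ideal.span {w}))]
    (hw : w ∈ nonZeroDivisors R)
    [HasExt.{max v (u + 1)} (GrMod (quotientGrading 𝓡 (Ideal.span {w})))]
    (n : ℕ) (hn : ∀ (M : Type u) [AddCommGroup M] [Module R M] [Module.Finite R M],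
      HasProjectiveDimensionLE (ModuleCat.of R M) n)
    (M P : GrMod (quotientGrading 𝓡 (Ideal.span {w}))) [Projective P] (k : ℕ) (hk : n ≤ k)
    (x : Ext M P k) : x = 0 := by
  rcases k with _ | k
  · obtain rfl : n = 0 := by lia
    have hM := (ModuleCat.hasProjectiveDimensionLE_zero_iff _).1 (hn M)
    have hreg : IsSMulRegular M w := Module.Flat.isSMulRegular_of_nonZeroDivisors hw
    have hM0 : IsZero M := (IsZero.iff_id_eq_zero _).2 <| by
      ext x
      refine hreg ?_
      exact (restrict_smul_eq_zero (N := M) x).trans (restrict_smul_eq_zero (N := M) 0).symm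
    have := hM0.hasProjectiveDimensionLT_zero
    exact x.eq_zero_of_hasProjectiveDimensionLT 0 le_rfl
  · have := hn M
    exact ext_eq_zero_of_hasProjectiveDimensionLE hw P k M
      (hasProjectiveDimensionLT_of_ge _ (n + 1) _ (by lia)) x

end GrMod

/-! ### Morphisms in Verdier quotients -/

section Verdier

open Pretriangulated

variable {T : Type*} [Category* T] [HasZeroObject T] [Preadditive T] [HasShift T ℤ]
  [∀ n : ℤ, (shiftFunctor T n).Additive] [Pretriangulated T] [IsTriangulated T]

/-- Morphisms from `X` to `Y` are unchanged in the Verdier quotient by `P` when every morphism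
`E ⟶ Y` from an object of `P` factors through an object of `P` to which, as well as to whose shift,
`X` has no nonzero morphisms. -/
theorem CategoryTheory.ObjectProperty.trW_Q_map_bijective (P : ObjectProperty T) [P.IsTriangulated]
    (X Y : T) (hXY : ∀ (E : T) (g : E ⟶ Y), P E → ∃ (E' : T) (u : E ⟶ E') (v : E' ⟶ Y),
      P E' ∧ u ≫ v = g ∧ (∀ h : X ⟶ E', h = 0) ∧ ∀ h : X ⟶ E'⟦(1 : ℤ)⟧, h = 0) :
    Function.Bijective (P.trW.Q.map : (X ⟶ Y) → _) := by
  constructor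
  · intro f f' hf
    -- The difference of `f` and `f'` factors through some `E ⟶ Y`, hence through some `E'`.
    rw [MorphismProperty.map_eq_iff_postcomp P.trW.Q P.trW] at hf
    obtain ⟨Z, s, hs, h⟩ := hf
    obtain ⟨E, g, δ, hT, hE⟩ := (P.trW_iff' s).1 hs
    obtain ⟨h', hh'⟩ : ∃ h' : X ⟶ E, f - f' = h' ≫ g := Triangle.coyoneda_exact₂ _ hT (f - f') (by
      change (f - f') ≫ s = 0
      rw [Preadditive.sub_comp, h, sub_self])
    obtain ⟨E', u, v, -, huv, h0, -⟩ := hXY E g hE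
    rw [← sub_eq_zero, hh', ← huv, ← Category.assoc, h0 (h' ≫ u), zero_comp]
  · intro φ
    -- Write `φ` as a fraction `X ⟶ Y' ⟵ Y`, with `E ⟶ Y ⟶ Y'` distinguished, and compare `Y'` with
    -- the cone `Y''` of `E' ⟶ Y`: the composite `X ⟶ Y' ⟶ Y''` lifts to `Y`.
    obtain ⟨ψ, hψ⟩ := Localization.exists_leftFraction P.trW.Q P.trW φ
    obtain ⟨E, g, δ, hT, hE⟩ := (P.trW_iff' ψ.s).1 ψ.hs
    obtain ⟨E', u, v, hE', huv, -, h1⟩ := hXY E g hE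
    obtain ⟨Y'', s', δ', hT'⟩ := distinguished_cocone_triangle v
    obtain ⟨c, hc⟩ : ∃ c : ψ.Y' ⟶ Y'', s' = ψ.s ≫ c := Triangle.yoneda_exact₂ _ hT s' (by
      change g ≫ s' = 0
      rw [← huv, Category.assoc, show v ≫ s' = 0 from comp_distTriang_mor_zero₁₂ _ hT', comp_zero])
    obtain ⟨f', hf'⟩ : ∃ f' : X ⟶ Y, ψ.f ≫ c = f' ≫ s' :=
      Triangle.coyoneda_exact₃ _ hT' (ψ.f ≫ c) (h1 _)
    have : IsIso (P.trW.Q.map s') :=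
      Localization.inverts P.trW.Q P.trW _ ((P.trW_iff' s').2 ⟨_, _, _, hT', hE'⟩)
    refine ⟨f', ?_⟩
    rw [← cancel_mono (P.trW.Q.map s'), ← Functor.map_comp, ← hf', hc, Functor.map_comp,
      Functor.map_comp, hψ, MorphismProperty.LeftFraction.map_comp_map_s_assoc]

end Verdier

/-! ### Bounded complexes of projectives -/

namespace DerivedCategory

variable {C : Type*} [Category* C] [Abelian C]

open CochainComplex HomologicalComplex

/-- A complex of projectives in degrees `[a, b]` has its term of degree `b` as a subcomplex; the
quotient is its stupid truncation in degrees `[a, b - 1]`. -/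
theorem exists_shortExact_single {K : CochainComplex C ℤ} (a b : ℤ) [K.IsStrictlyGE a]
    [K.IsStrictlyLE b] (hK : ∀ i, Projective (K.X i)) :
    ∃ S : ShortComplex (CochainComplex C ℤ), S.ShortExact ∧
      S.X₁ = (CochainComplex.singleFunctor C b).obj (K.X b) ∧ S.X₂ = K ∧
      S.X₃.IsStrictlyGE a ∧ S.X₃.IsStrictlyLE (b - 1) ∧ ∀ i, Projective (S.X₃.X i) := by
  let f : (CochainComplex.singleFunctor C b).obj (K.X b) ⟶ K := mkHomFromSingle (𝟙 _) (by
    rintro _ rfl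
    exact (K.isZero_of_isStrictlyLE b (b + 1) (by simp)).eq_of_tgt _ _)
  have hzero : ∀ i, i ≠ b → IsZero (((CochainComplex.singleFunctor C b).obj (K.X b)).X i) :=
    fun i hi => isZero_single_obj_X _ _ _ _ hi
  have hiso : IsIso (f.f b) := by
    have : f.f b = (singleObjXSelf (ComplexShape.up ℤ) b (K.X b)).hom := by
      simp only [f, mkHomFromSingle_f, Category.comp_id]
      rfl
    rw [this]
    exact Iso.isIso_hom _
  have hmono : ∀ i, Mono (f.f i) := fun i => by
    by_cases hi : i = b
    · subst hi
      infer_instance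
    · exact ⟨fun _ _ _ => (hzero i hi).eq_of_tgt _ _⟩
  have : Mono f := HomologicalComplex.mono_of_mono_f f hmono
  have hS : (ShortComplex.mk f (cokernel.π f) (cokernel.condition f)).ShortExact :=
    { exact := ShortComplex.exact_cokernel f }
  have hSi := fun i => hS.map_of_exact (HomologicalComplex.eval C (ComplexShape.up ℤ) i)
  have hb : IsZero ((cokernel f).X b) := (hSi b).isIso_f_iff.1 hiso
  have e : ∀ i, i ≠ b → Nonempty (K.X i ≅ (cokernel f).X i) := fun i hi => by
    have : IsIso ((cokernel.π f).f i) := (hSi i).isIso_g_iff.2 (hzero i hi)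
    exact ⟨asIso ((cokernel.π f).f i)⟩
  refine ⟨_, hS, rfl, rfl, ?_, ?_, ?_⟩
  · rw [CochainComplex.isStrictlyGE_iff]
    intro i hi
    by_cases hib : i = b
    · exact hib ▸ hb
    · exact (K.isZero_of_isStrictlyGE a i hi).of_iso (e i hib).some.symm
  · rw [CochainComplex.isStrictlyLE_iff]
    intro i hi
    by_cases hib : i = b
    · exact hib ▸ hb
    · exact (K.isZero_of_isStrictlyLE b i (by lia)).of_iso (e i hib).some.symm
  · intro i
    by_cases hib : i = b
    · subst hib
      exact Projective.of_iso (hb.isoZero).symm inferInstance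
    · exact Projective.of_iso (e i hib).some (hK i)

variable [HasDerivedCategory C]

open Pretriangulated

/-- A morphism from a bounded complex of projectives to a complex concentrated in degrees `≤ m`
factors through the stupid truncation in degrees `≤ m`. The `r` terms in higher degrees are removed
one by one; they admit no nonzero morphisms to the target. -/
theorem exists_factorization_of_projective {L : CochainComplex C ℤ} (m : ℤ) [L.IsStrictlyLE m]
    (a : ℤ) (r : ℕ) (K : CochainComplex C ℤ) [K.IsStrictlyGE a] [K.IsStrictlyLE (m + r)]
    (hK : ∀ i, Projective (K.X i)) (f : Q.obj K ⟶ Q.obj L) :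
    ∃ (K' : CochainComplex C ℤ) (u : Q.obj K ⟶ Q.obj K') (v : Q.obj K' ⟶ Q.obj L),
      K'.IsStrictlyGE a ∧ K'.IsStrictlyLE m ∧ (∀ i, Projective (K'.X i)) ∧ u ≫ v = f := by
  induction r generalizing K with
  | zero =>
    exact ⟨K, 𝟙 _, f, inferInstance, by
      simpa using ‹K.IsStrictlyLE (m + (0 : ℕ))›, hK, Category.id_comp f⟩
  | succ r ih =>
    obtain ⟨S, hS, h₁, rfl, _, h₃, hp⟩ := exists_shortExact_single a (m + (r + 1 : ℕ)) hK
    have : S.X₃.IsStrictlyLE (m + r) := by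
      rwa [show m + (r + 1 : ℕ) - 1 = m + r by lia] at h₃
    have := hK (m + (r + 1 : ℕ))
    obtain ⟨f', hf'⟩ : ∃ f' : Q.obj S.X₃ ⟶ Q.obj L, f = Q.map S.g ≫ f' :=
      Triangle.yoneda_exact₂ _ (triangleOfSES_distinguished hS) f (by
      change Q.map S.f ≫ f = 0
      generalize Q.map S.f ≫ f = g
      revert g
      rw [h₁]
      exact fun g => from_singleFunctor_obj_eq_zero_of_projective g m (by lia))
    obtain ⟨K', u, v, hGE, hLE, hK', rfl⟩ := ih S.X₃ hp f'
    exact ⟨K', Q.map S.g ≫ u, v, hGE, hLE, hK', by rw [Category.assoc]; exact hf'.symm⟩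

/-- An object without nonzero morphisms to single projectives in degrees `≤ m` has none to bounded
complexes of projectives in degrees `≤ m`. -/
theorem eq_zero_of_projective_complex {X : DerivedCategory C} (m : ℤ)
    (hX : ∀ (P : C) [Projective P] (b : ℤ), b ≤ m →
      ∀ f : X ⟶ Q.obj ((CochainComplex.singleFunctor C b).obj P), f = 0)
    (a : ℤ) (r : ℕ) (K : CochainComplex C ℤ) [K.IsStrictlyGE a] [K.IsStrictlyLE (a - 1 + r)]
    [K.IsStrictlyLE m] (hK : ∀ i, Projective (K.X i)) (f : X ⟶ Q.obj K) : f = 0 := by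
  induction r generalizing K with
  | zero =>
    refine (Q.map_isZero ((IsZero.iff_id_eq_zero _).2 ?_)).eq_of_tgt _ _
    ext i
    rcases lt_or_ge i a with hi | hi
    · exact (K.isZero_of_isStrictlyGE a i hi).eq_of_tgt _ _
    · exact (K.isZero_of_isStrictlyLE (a - 1 + (0 : ℕ)) i (by lia)).eq_of_tgt _ _
  | succ r ih =>
    have hb : ∃ b, b ≤ m ∧ b ≤ a + r ∧ K.IsStrictlyLE b := by
      rcases le_total m (a + r) with h | h
      · exact ⟨m, le_rfl, h, inferInstance⟩
      · exact ⟨_, h, le_rfl, by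
          rwa [show a - 1 + (r + 1 : ℕ) = a + r by lia] at ‹K.IsStrictlyLE (a - 1 + (r + 1 : ℕ))›⟩
    obtain ⟨b, hbm, hbr, _⟩ := hb
    obtain ⟨S, hS, h₁, rfl, _, h₃, hp⟩ := exists_shortExact_single a b hK
    have := S.X₃.isStrictlyLE_of_le (b - 1) m (by lia)
    have := S.X₃.isStrictlyLE_of_le (b - 1) (a - 1 + r) (by lia)
    have := hK b
    obtain ⟨f', hf'⟩ : ∃ f' : X ⟶ Q.obj S.X₁, f = f' ≫ Q.map S.f :=
      Triangle.coyoneda_exact₂ _ (triangleOfSES_distinguished hS) f (ih S.X₃ hp _)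
    have hf'' : f' = 0 := by
      clear hf'
      revert f'
      rw [h₁]
      exact hX _ b hbm
    rw [hf', hf'', zero_comp]

end DerivedCategory

/-! ### Perfect complexes in the bounded derived category -/

namespace DerivedCategory

universe w

variable {C : Type*} [Category* C] [Abelian C] [HasDerivedCategory C]

open Pretriangulated TStructure

/-- The functor to the bounded derived category sending an object to the complex concentrated in
degree zero. -/
noncomputable abbrev Bounded.singleFunctor (C : Type*) [Category* C] [Abelian C]
    [HasDerivedCategory C] : C ⥤ Bounded C :=
  t.bounded.lift (DerivedCategory.singleFunctor C 0)
    fun _ => ⟨⟨0, inferInstance⟩, ⟨0, inferInstance⟩⟩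

theorem Bounded.exists_distinguished_of_shortExact {S : ShortComplex C} (hS : S.ShortExact) :
    ∃ δ : (Bounded.singleFunctor C).obj S.X₃ ⟶ ((Bounded.singleFunctor C).obj S.X₁)⟦(1 : ℤ)⟧,
      Triangle.mk ((Bounded.singleFunctor C).map S.f) ((Bounded.singleFunctor C).map S.g) δ ∈
        distTriang (Bounded C) := by
  refine ⟨t.bounded.fullyFaithfulι.preimage (hS.singleδ ≫
    (Bounded.ι.commShiftIso (1 : ℤ)).inv.app ((Bounded.singleFunctor C).obj S.X₁)), ?_⟩
  refine isomorphic_distinguished _ hS.singleTriangle_distinguished _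
    (Triangle.isoMk _ _ (Iso.refl _) (Iso.refl _) (Iso.refl _) ?_ ?_ ?_)
  · exact (Category.comp_id _).trans (Category.id_comp _).symm
  · exact (Category.comp_id _).trans (Category.id_comp _).symm
  · refine ((congrArg (_ ≫ ·) (CategoryTheory.Functor.map_id _ _)).trans
      (Category.comp_id _)).trans (Eq.trans ?_ (Category.id_comp _).symm)
    exact (Category.assoc _ _ _).trans ((congrArg (hS.singleδ ≫ ·) (Iso.inv_hom_id_app
      (Bounded.ι.commShiftIso (1 : ℤ)) ((Bounded.singleFunctor C).obj S.X₁))).trans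
        (Category.comp_id _))

theorem perfect_singleFunctor_of_projective (P : C) [Projective P] :
    perfect C ((Bounded.singleFunctor C).obj P) := by
  refine ⟨(CochainComplex.singleFunctor C 0).obj P, 0, 0, inferInstance, inferInstance,
    fun i => ?_, ⟨Iso.refl _⟩⟩
  by_cases hi : i = 0
  · subst hi
    exact Projective.of_iso (HomologicalComplex.singleObjXSelf (ComplexShape.up ℤ) 0 P).symm
      inferInstance
  · exact Projective.of_iso
      (HomologicalComplex.isZero_single_obj_X (ComplexShape.up ℤ) 0 P i hi).isoZero.symm
      inferInstance

/-- Morphisms `X ⟶ Y⟦k⟧` are unchanged in the quotient by the perfect complexes when `Ext` from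
`X` to projectives vanishes in degrees at least `k`. -/
theorem perfect_trW_Q_map_bijective (X Y : C) (k : ℤ)
    (hX : ∀ (P : C) [Projective P] (b : ℤ), b ≤ -k →
      ∀ f : (singleFunctor C 0).obj X ⟶ (singleFunctor C b).obj P, f = 0) :
    Function.Bijective ((perfect C).trW.Q.map :
      ((Bounded.singleFunctor C).obj X ⟶ ((Bounded.singleFunctor C).obj Y)⟦k⟧) → _) := by
  refine ObjectProperty.trW_Q_map_bijective _ _ _ fun E g hE => ?_
  obtain ⟨K, a, b, hGE, hLE, hK, ⟨e⟩⟩ := hE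
  let e' : (((Bounded.singleFunctor C).obj Y)⟦k⟧).obj ≅
      Q.obj ((CochainComplex.singleFunctor C (-k)).obj Y) :=
    (Bounded.ι.commShiftIso k).app _ ≪≫ ((singleFunctors C).shiftIso k (-k) 0 (by simp)).app Y
  have : K.IsStrictlyLE (-k + (b + k).toNat) := K.isStrictlyLE_of_le b _ (by lia)
  obtain ⟨K', u, v, hGE', hLE', hK', huv⟩ := exists_factorization_of_projective
    (L := (CochainComplex.singleFunctor C (-k)).obj Y) (-k) a (b + k).toNat K hK
      (e.inv ≫ g.hom ≫ e'.hom)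
  let E' : Bounded C := ⟨Q.obj K', ⟨⟨a, inferInstance⟩, ⟨-k, inferInstance⟩⟩⟩
  refine ⟨E', t.bounded.fullyFaithfulι.preimage (e.hom ≫ u),
    t.bounded.fullyFaithfulι.preimage (v ≫ e'.inv),
    ⟨K', a, -k, inferInstance, inferInstance, hK', ⟨Iso.refl _⟩⟩, ?_, fun h => ?_, fun h => ?_⟩
  · apply t.bounded.ι.map_injective
    simp [reassoc_of% huv]
  · apply t.bounded.ι.map_injective
    have : K'.IsStrictlyLE (a - 1 + (-k - a + 1).toNat) := K'.isStrictlyLE_of_le (-k) _ (by lia)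
    rw [Functor.map_zero]
    exact eq_zero_of_projective_complex (-k) hX a (-k - a + 1).toNat K' hK' _
  · apply t.bounded.ι.map_injective
    have := K'.isStrictlyGE_shift a 1 (a - 1) (by lia)
    have := K'.isStrictlyLE_shift (-k) 1 (-k - 1) (by lia)
    have := (K'⟦(1 : ℤ)⟧).isStrictlyLE_of_le (-k - 1) (-k) (by lia)
    have : (K'⟦(1 : ℤ)⟧).IsStrictlyLE (a - 1 - 1 + (-k - a + 1).toNat) :=
      (K'⟦(1 : ℤ)⟧).isStrictlyLE_of_le (-k - 1) _ (by lia)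
    have e'' : (E'⟦(1 : ℤ)⟧).obj ≅ Q.obj (K'⟦(1 : ℤ)⟧) :=
      (Bounded.ι.commShiftIso (1 : ℤ)).app E' ≪≫ ((Q.commShiftIso (1 : ℤ)).app K').symm
    rw [Functor.map_zero, ← cancel_mono e''.hom, zero_comp]
    exact eq_zero_of_projective_complex (-k) hX (a - 1) (-k - a + 1).toNat (K'⟦(1 : ℤ)⟧)
      (fun i => hK' _) _

open Abelian in
theorem eq_zero_of_ext_eq_zero [HasExt.{w} C] (X Y : C) (k : ℕ) (h : ∀ x : Ext X Y k, x = 0)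
    (b : ℤ) (hb : b = -k)
    (f : (singleFunctor C 0).obj X ⟶ (singleFunctor C b).obj Y) : f = 0 := by
  let e := ((singleFunctors C).shiftIso k b 0 (by lia)).app Y
  rw [← cancel_mono e.inv, zero_comp]
  apply Ext.homEquiv.symm.injective
  rw [h (Ext.homEquiv.symm (f ≫ e.inv)), h (Ext.homEquiv.symm 0)]

end DerivedCategory

/-! ### Periodicity in the category of singularities -/

section

open DerivedCategory Pretriangulated

variable {C : Type*} [Category* C] [Abelian C] [HasDerivedCategory C]

/-- If the middle term of a short exact sequence is perfect, its connecting morphism becomes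
invertible in the quotient by the perfect complexes. -/
theorem nonempty_iso_shift_of_perfect {S : ShortComplex C} (hS : S.ShortExact)
    (h : perfect C ((Bounded.singleFunctor C).obj S.X₂)) :
    Nonempty ((perfect C).trW.Q.obj ((Bounded.singleFunctor C).obj S.X₃) ≅
      ((perfect C).trW.Q.obj ((Bounded.singleFunctor C).obj S.X₁))⟦(1 : ℤ)⟧) := by
  obtain ⟨δ, hδ⟩ := Bounded.exists_distinguished_of_shortExact hS
  have : IsIso ((perfect C).trW.Q.map δ) := Localization.inverts _ (perfect C).trW _
    (ObjectProperty.trW.mk' _ (rot_of_distTriang _ hδ) h)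
  exact ⟨asIso ((perfect C).trW.Q.map δ) ≪≫ ((perfect C).trW.Q.commShiftIso (1 : ℤ)).app _⟩

end

namespace GrMod

variable {L : Type v} [AddCommGroup L] [DecidableEq L]

theorem perfect_of_hasProjectiveDimensionLE {A : Type u} [CommRing A] [IsNoetherianRing A]
    {𝒜 : L → AddSubgroup A} [GradedRing 𝒜] (m : ℕ) (M : GrMod 𝒜)
    (hM : HasProjectiveDimensionLE (ModuleCat.of A M) m) :
    perfect (GrMod 𝒜) ((moduleToDb 𝒜).obj M) := by
  induction m generalizing M with
  | zero =>
    have := (ModuleCat.hasProjectiveDimensionLE_zero_iff _).1 hM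
    have := projective_of_module_projective (iSup_grading_eq_top 𝒜) M
    exact DerivedCategory.perfect_singleFunctor_of_projective M
  | succ m ih =>
    obtain ⟨F, π, _, hπ⟩ := exists_free_cover M
    have := projective_of_module_projective (iSup_grading_eq_top 𝒜) F
    obtain ⟨δ, hδ⟩ :=
      DerivedCategory.Bounded.exists_distinguished_of_shortExact (kerι_shortExact π hπ)
    exact (perfect (GrMod 𝒜)).ext_of_isTriangulatedClosed₃ _ hδ
      (ih (ker π) ((ModuleCat.hasProjectiveDimensionLE_ker_iff π.toLin hπ m).1 hM))
      (DerivedCategory.perfect_singleFunctor_of_projective F)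

section Shift

variable {A : Type u} [CommRing A] {𝒜 : L → AddSubgroup A}

theorem nonempty_iso_of_linearEquiv {M N : GrMod 𝒜} (e : M ≃ₗ[A] N)
    (h : ∀ i x, x ∈ M.gr i ↔ e x ∈ N.gr i) : Nonempty (M ≅ N) :=
  ⟨{ hom := ⟨e, fun {i m} => (h i m).1⟩
     inv := ⟨e.symm, fun {i m} hm => (h i _).2 (by rwa [← e.apply_symm_apply m] at hm)⟩
     hom_inv_id := by ext x; exact e.symm_apply_apply x
     inv_hom_id := by ext x; exact e.apply_symm_apply x }⟩

theorem nonempty_shift_zero_iso (M : GrMod 𝒜) {l : L} (hl : l = 0) : Nonempty (M.shift l ≅ M) := by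
  subst hl
  refine nonempty_iso_of_linearEquiv (LinearEquiv.refl A M) fun i x => ?_
  change x ∈ M.gr (0 + i) ↔ x ∈ M.gr i
  rw [zero_add]

theorem nonempty_shift_shift_iso (M : GrMod 𝒜) {a b c : L} (h : a + b = c) :
    Nonempty ((M.shift a).shift b ≅ M.shift c) := by
  subst h
  refine nonempty_iso_of_linearEquiv (LinearEquiv.refl A M) fun i x => ?_
  change x ∈ M.gr (a + (b + i)) ↔ x ∈ M.gr (a + b + i)
  rw [add_assoc]

end Shift

variable {R : Type u} [CommRing R] {𝓡 : L → AddSubgroup R} {w : R} {d : L}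

/-- In the category of singularities `N` is isomorphic to `N(-d)[2]`. -/
theorem nonempty_iso_shift_two [IsNoetherianRing R] [GradedRing 𝓡]
    [GradedRing (quotientGrading 𝓡 (Ideal.span {w}))] (hwd : w ∈ 𝓡 d)
    (hw : w ∈ nonZeroDivisors R) (n : ℕ)
    (hn : ∀ (M : Type u) [AddCommGroup M] [Module R M] [Module.Finite R M],
      HasProjectiveDimensionLE (ModuleCat.of R M) n)
    (N : GrMod (quotientGrading 𝓡 (Ideal.span {w}))) :
    Nonempty ((dbToDsg _).obj ((moduleToDb _).obj N) ≅
      ((dbToDsg _).obj ((moduleToDb _).obj (N.shift (-d))))⟦(2 : ℤ)⟧) := by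
  obtain ⟨S, T, hS, hT, h₁, h₂, rfl, hS₂, hT₂⟩ := exists_periodicity_sequences hwd hw n hn N
  obtain ⟨e⟩ := nonempty_iso_shift_of_perfect hS (perfect_of_hasProjectiveDimensionLE n _ hS₂)
  obtain ⟨e'⟩ := nonempty_iso_shift_of_perfect hT (perfect_of_hasProjectiveDimensionLE 0 _
    ((ModuleCat.hasProjectiveDimensionLE_zero_iff _).2 hT₂))
  rw [← h₂] at e'
  rw [← h₁]
  exact ⟨e' ≪≫ (shiftFunctor _ (1 : ℤ)).mapIso e ≪≫
    ((shiftFunctorAdd' (Dsg _) (1 : ℤ) 1 2 rfl).app _).symm⟩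

/-- In the category of singularities `N` is isomorphic to `N(-j d)[2 j]`. -/
theorem nonempty_iso_shift_two_mul [IsNoetherianRing R] [GradedRing 𝓡]
    [GradedRing (quotientGrading 𝓡 (Ideal.span {w}))] (hwd : w ∈ 𝓡 d)
    (hw : w ∈ nonZeroDivisors R) (n : ℕ)
    (hn : ∀ (M : Type u) [AddCommGroup M] [Module R M] [Module.Finite R M],
      HasProjectiveDimensionLE (ModuleCat.of R M) n)
    (N : GrMod (quotientGrading 𝓡 (Ideal.span {w}))) (j : ℤ) :
    Nonempty ((dbToDsg _).obj ((moduleToDb _).obj N) ≅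
      ((dbToDsg _).obj ((moduleToDb _).obj (N.shift (-(j • d)))))⟦2 * j⟧) := by
  let G := moduleToDb (quotientGrading 𝓡 (Ideal.span {w})) ⋙ dbToDsg _
  change Nonempty (G.obj N ≅ (G.obj (N.shift (-(j • d))))⟦2 * j⟧)
  induction j using Int.induction_on with
  | zero =>
    obtain ⟨e⟩ := nonempty_shift_zero_iso N (l := -((0 : ℤ) • d)) (by simp)
    exact ⟨G.mapIso e.symm ≪≫ ((shiftFunctorZero' (Dsg _) (2 * 0 : ℤ) rfl).app _).symm⟩
  | succ j ih =>
    obtain ⟨e⟩ := ih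
    obtain ⟨p⟩ := nonempty_iso_shift_two hwd hw n hn (N.shift (-((j : ℤ) • d)))
    obtain ⟨q⟩ := nonempty_shift_shift_iso N (a := -((j : ℤ) • d)) (b := -d)
      (c := -((j + 1 : ℤ) • d)) (by rw [add_smul, one_smul, neg_add])
    exact ⟨e ≪≫ (shiftFunctor _ (2 * j : ℤ)).mapIso
      (p ≪≫ (shiftFunctor _ (2 : ℤ)).mapIso (G.mapIso q)) ≪≫
      ((shiftFunctorAdd' (Dsg _) (2 : ℤ) (2 * j) (2 * (j + 1)) (by ring)).app _).symm⟩
  | pred j ih =>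
    obtain ⟨e⟩ := ih
    obtain ⟨p⟩ := nonempty_iso_shift_two hwd hw n hn (N.shift (-((-j - 1 : ℤ) • d)))
    obtain ⟨q⟩ := nonempty_shift_shift_iso N (a := -((-j - 1 : ℤ) • d)) (b := -d)
      (c := -((-j : ℤ) • d)) (by rw [sub_smul, one_smul, neg_sub]; abel)
    exact ⟨e ≪≫ (shiftFunctor _ (2 * -j : ℤ)).mapIso
      (((shiftFunctorCompIsoId (Dsg _) (2 : ℤ) (-2) (by simp)).app _).symm ≪≫
        (shiftFunctor _ (-2 : ℤ)).mapIso
          (p ≪≫ (shiftFunctor _ (2 : ℤ)).mapIso (G.mapIso q)).symm) ≪≫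
      ((shiftFunctorAdd' (Dsg _) (-2 : ℤ) (2 * -j) (2 * (-j - 1)) (by ring)).app _).symm⟩

end GrMod

/-! ### Comparison of morphisms -/

namespace GrMod

variable {L : Type v} [AddCommGroup L] [DecidableEq L] {R : Type u} [CommRing R]
  {𝓡 : L → AddSubgroup R} {w : R} {d : L}

open Abelian in
/-- Morphisms `M ⟶ N⟦k⟧` with `k ≥ n` are unchanged in the category of singularities. -/
theorem dbToDsg_map_bijective [IsNoetherianRing R]
    [GradedRing (quotientGrading 𝓡 (Ideal.span {w}))]
    (hw : w ∈ nonZeroDivisors R) (n : ℕ)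
    (hn : ∀ (M : Type u) [AddCommGroup M] [Module R M] [Module.Finite R M],
      HasProjectiveDimensionLE (ModuleCat.of R M) n)
    (M N : GrMod (quotientGrading 𝓡 (Ideal.span {w}))) (k : ℤ) (hk : n ≤ k) :
    Function.Bijective ((dbToDsg _).map :
      ((moduleToDb _).obj M ⟶ ((moduleToDb _).obj N)⟦k⟧) → _) := by
  have : HasExt.{max v (u + 1)} (GrMod (quotientGrading 𝓡 (Ideal.span {w}))) :=
    hasExt_of_hasDerivedCategory _
  refine DerivedCategory.perfect_trW_Q_map_bijective M N k fun P _ b hb f => ?_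
  obtain ⟨m, rfl⟩ : ∃ m : ℕ, b = -m := ⟨(-b).toNat, by lia⟩
  exact DerivedCategory.eq_zero_of_ext_eq_zero M P m
    (ext_eq_zero_of_forall_hasProjectiveDimensionLE hw n hn M P m (by lia)) _ rfl f

end GrMod

theorem mainTheorem4 {L : Type v} [AddCommGroup L] [DecidableEq L] {R : Type u} [CommRing R]
    [IsRegularRing R] (n : ℕ) (hn : ringKrullDim R = n)
    (𝓡 : L → AddSubgroup R) [GradedRing 𝓡]
    (w : R) (d : L) (hwd : w ∈ 𝓡 d) (hw : w ∈ nonZeroDivisors R)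
    (N : GrMod (quotientGrading 𝓡 (Ideal.span {w}))) (i j : ℤ) (hj : ((n : ℚ) - i) / 2 ≤ j) :
    ∃ φ : ∀ M : GrMod (quotientGrading 𝓡 (Ideal.span {w})),
        ((dbToDsg _).obj ((moduleToDb _).obj M) ⟶ ((dbToDsg _).obj ((moduleToDb _).obj N))⟦i⟧) ≃+
          ((moduleToDb _).obj M ⟶ ((moduleToDb _).obj (N.shift (-(j • d))))⟦i + 2 * j⟧),
      ∀ (M M' : GrMod (quotientGrading 𝓡 (Ideal.span {w}))) (f : M' ⟶ M)
        (g : (dbToDsg _).obj ((moduleToDb _).obj M) ⟶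
          ((dbToDsg _).obj ((moduleToDb _).obj N))⟦i⟧),
        φ M' ((dbToDsg _).map ((moduleToDb _).map f) ≫ g) = (moduleToDb _).map f ≫ φ M g := by
  have hpd := fun (M : Type u) [AddCommGroup M] [Module R M] [Module.Finite R M] =>
    IsRegularRing.hasProjectiveDimensionLE hn.le M
  obtain ⟨_⟩ := quotientGrading_gradedRing 𝓡 (Ideal.span {w})
    (Ideal.homogeneous_span 𝓡 {w} (by rintro _ rfl; exact ⟨d, hwd⟩))
  have hij : (n : ℤ) ≤ i + 2 * j := by
    have : (n : ℚ) ≤ ((i + 2 * j : ℤ) : ℚ) := by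
      push_cast
      linarith
    exact_mod_cast this
  obtain ⟨e⟩ := GrMod.nonempty_iso_shift_two_mul hwd hw n hpd N j
  let β : ((dbToDsg _).obj ((moduleToDb _).obj N))⟦i⟧ ≅
      (dbToDsg _).obj (((moduleToDb _).obj (N.shift (-(j • d))))⟦i + 2 * j⟧) :=
    (shiftFunctor _ i).mapIso e ≪≫
      ((shiftFunctorAdd' (Dsg _) (2 * j) i (i + 2 * j) (add_comm _ _)).app _).symm ≪≫
      ((dbToDsg _).commShiftIso (i + 2 * j)).symm.app _
  have hbij := fun M => GrMod.dbToDsg_map_bijective hw n hpd M (N.shift (-(j • d))) _ hij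
  let q := fun M => AddEquiv.ofBijective (dbToDsg _).mapAddHom (hbij M)
  refine ⟨fun M => AddEquiv.trans
    { toFun := fun g => g ≫ β.hom
      invFun := fun g => g ≫ β.inv
      left_inv := fun g => by simp
      right_inv := fun g => by simp
      map_add' := fun g g' => Preadditive.add_comp _ _ _ _ _ _ } (q M).symm, ?_⟩
  intro M M' f g
  apply (q M').injective
  refine ((q M').apply_symm_apply _).trans ?_
  refine Eq.trans ?_ ((dbToDsg _).map_comp _ _).symm
  have : (dbToDsg _).map ((q M).symm (g ≫ β.hom)) = g ≫ β.hom := (q M).apply_symm_apply _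
  refine (Category.assoc ((dbToDsg _).map ((moduleToDb _).map f)) g β.hom).trans ?_
  exact congrArg ((dbToDsg (quotientGrading 𝓡 (Ideal.span {w}))).map ((moduleToDb _).map f) ≫ ·)
    this.symm
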